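/- Let $d\ge 1$, $k\ge 2$ and $0\le\beta\le k-1$ be integers. For $z\in\mathbb{C}^d$ write $|z|=\sqrt{|z_1|^2+\cdots+|z_d|^2}$. For a polynomial $Q\in\mathbb{C}[z_1,\dots,z_d]$ let $Q^{*}$ be the polynomial obtained by conjugating the coefficients of $Q$, and let $Q(D)$ be the linear differential operator obtained by replacing each variable $z_i$ with $\partial/\partial z_i$. The order of an entire function $f:\mathbb{C}^d\to\mathbb{C}$ is $$\rho(f)=\limsup_{r\to\infty}\frac{\log\log M(f,r)}{\log r},\qquad M(f,r)=\sup\{|f(z)|: z\in\mathbb{C}^d,\ |z|=r\},$$ with the convention that constant functions have order $0$. Let $P\in\mathbb{C}[z_1,\dots,z_d]$ be a non-homogeneous polynomial of degree $k$ with expansion into homogeneous parts $P=P_0+\cdots+P_\beta+P_k$, where $P_j$ is the homogeneous part of degree $j$ (so $P_j=0$ for $\beta<j<k$, and $P_0,\dots,P_\beta$ may individually vanish). Let $\varphi:\mathbb{C}^d\to\mathbb{C}$ be an entire function satisfying $$P_k^{*}(D)(P\varphi)=0$$ whose order $\rho$ satisfies $\rho<\dfrac{2(k-\beta)}{k}$.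 Then $\varphi=0$. -/

import Mathlib

noncomputable section

namespace Fischer

variable {d : ℕ}

/-- The complex partial derivative `∂f/∂z_i` of a function on `ℂ^d`. -/
def partialD (i : Fin d) (f : EuclideanSpace ℂ (Fin d) → ℂ) : EuclideanSpace ℂ (Fin d) → ℂ :=
  fun z => fderiv ℂ f z (EuclideanSpace.single i 1)

/-- The iterated partial derivative `∂^α f = ∂_1^{α_1} ⋯ ∂_d^{α_d} f` for a multi-index `α`. -/
def multiD (α : Fin d →₀ ℕ) (f : EuclideanSpace ℂ (Fin d) → ℂ) : EuclideanSpace ℂ (Fin d) → ℂ :=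
  (List.finRange d).foldr (fun i g => (partialD i)^[α i] g) f

/-- The differential operator `Q(D)`: each variable `z_i` of `Q` is replaced by `∂/∂z_i`. -/
def diffOp (Q : MvPolynomial (Fin d) ℂ) (f : EuclideanSpace ℂ (Fin d) → ℂ) :
    EuclideanSpace ℂ (Fin d) → ℂ :=
  fun z => ∑ α ∈ Q.support, Q.coeff α * multiD α f z

/-- The polynomial `P^*`, obtained from `P` by conjugating its coefficients. -/
def conjCoeffs (P : MvPolynomial (Fin d) ℂ) : MvPolynomial (Fin d) ℂ :=
  MvPolynomial.map (starRingEnd ℂ) P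

/-- `M(f, r) = sup {|f(z)| : |z| = r}`, where `|z|` is the Euclidean norm on `ℂ^d`. -/
def maxModulus (f : EuclideanSpace ℂ (Fin d) → ℂ) (r : ℝ) : ℝ :=
  sSup {x : ℝ | ∃ z : EuclideanSpace ℂ (Fin d), ‖z‖ = r ∧ x = ‖f z‖}

/-- The order `limsup_{r → ∞} log log M(f, r) / log r` of an entire function, as an extended real
number. For a nonconstant entire function (`d ≥ 1`) both logarithms have positive arguments for
large `r`; for a constant function the conventions of `Real.log` give the usual value `0`. -/
def order (f : EuclideanSpace ℂ (Fin d) → ℂ) : EReal :=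
  Filter.limsup
    (fun r : ℝ => ((Real.log (Real.log (maxModulus f r)) / Real.log r : ℝ) : EReal)) Filter.atTop

end Fischer

end

/-! In the Fischer inner product, where monomials are orthogonal and `z^α` has squared norm `α!`,
multiplication by `P_k` is adjoint to `P_k^*(D)`. The equation therefore says that each homogeneous
part of `Pφ` is orthogonal to all multiples of `P_k` (`inner_fischerVec_eq_zero`). Pairing the part
of degree `k + M` with `P_k φ_M`, where `φ_m` is the part of `φ` of degree `m`, gives `‖P_k φ_M‖ ≤
‖∑_{j ≤ β} P_j φ_{k-j+M}‖`.

Bombieri's inequality bounds the left side below by a fixed positive multiple of `‖φ_M‖`, and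
multiplication by `P_j` costs at most a constant times `(k + M)^{j/2}`. Hence `φ_M` is controlled by
parts of strictly higher degree (`exists_recursion_bound`).

The weights `A^m (m!)^g` with `g = β / (2(k - β))` absorb these costs, so a nonzero weighted norm is
never larger than all later ones. Cauchy's estimates (`tendsto_weighted_norm_fischerVec`) send the
weighted norms to `0` when the order is below `1 / (g + 1/2) = 2(k - β)/k`. So every `φ_m` vanishes.
-/

noncomputable section

namespace Fischer

variable {d : ℕ}

/-! ### Complex differentiability implies smoothness in finite dimension. -/

section Smoothness

variable {E : Type*} [NormedAddCommGroup E] [NormedSpace ℂ E]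

lemma hasDerivAt_comp_line {f : E → ℂ} (hf : Differentiable ℂ f) (z v : E) (t : ℂ) :
    HasDerivAt (fun s : ℂ => f (z + s • v)) (fderiv ℂ f (z + t • v) v) t := by
  have h1 : HasDerivAt (fun s : ℂ => z + s • v) v t := by
    simpa using ((hasDerivAt_id t).smul_const v).const_add z
  exact (hf _).hasFDerivAt.comp_hasDerivAt t h1

lemma differentiable_comp_line {f : E → ℂ} (hf : Differentiable ℂ f) (z v : E) :
    Differentiable ℂ (fun s : ℂ => f (z + s • v)) :=
  fun t => (hasDerivAt_comp_line hf z v t).differentiableAt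

/-- Cauchy's estimate on the disc of radius `‖v‖⁻¹` in the line `w + t • v`, which stays in the
closed unit ball about `w`. -/
lemma norm_fderiv_le_of_bounded_near {f : E → ℂ} (hf : Differentiable ℂ f) (w : E) {C : ℝ}
    (hC : ∀ y, ‖y - w‖ ≤ 1 → ‖f y‖ ≤ C) : ‖fderiv ℂ f w‖ ≤ C := by
  have hC0 : 0 ≤ C := (norm_nonneg _).trans (hC w (by simp))
  refine ContinuousLinearMap.opNorm_le_bound _ hC0 fun v => ?_
  rcases eq_or_ne v 0 with rfl | hv
  · simp
  have hv' : 0 < ‖v‖ := norm_pos_iff.2 hv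
  have hder := (hasDerivAt_comp_line hf w v 0).deriv
  simp only [zero_smul, add_zero] at hder
  rw [← hder]
  refine (Complex.norm_deriv_le_of_forall_mem_sphere_norm_le (inv_pos.2 hv')
    (differentiable_comp_line hf w v).diffContOnCl (C := C) fun t ht => hC _ ?_).trans_eq
    (by rw [div_inv_eq_mul])
  have : ‖t‖ = ‖v‖⁻¹ := by simpa using ht
  simp [norm_smul, this, hv'.ne']

lemma fderiv_apply_eq_circleIntegral {f : E → ℂ} (hf : Differentiable ℂ f) (z v : E) :
    fderiv ℂ f z v = (2 * Real.pi * Complex.I : ℂ)⁻¹ •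
      ∮ ζ in C(0, 1), (1 / (ζ - 0) ^ 2) • f (z + ζ • v) := by
  rw [((differentiable_comp_line hf z v).differentiableOn).deriv_eq_smul_circleIntegral one_pos,
    (hasDerivAt_comp_line hf z v 0).deriv, inv_smul_smul₀ Complex.two_pi_I_ne_zero]
  simp

/-- Cauchy's integral formula writes the directional derivative as an integral of values of `f`,
which can be differentiated under the integral sign. -/
lemma differentiable_fderiv_apply [FiniteDimensional ℂ E] {f : E → ℂ} (hf : Differentiable ℂ f)
    (v : E) : Differentiable ℂ (fun z => fderiv ℂ f z v) := by
  have := FiniteDimensional.proper ℂ E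
  have := FiniteDimensional.proper ℂ (E →L[ℂ] ℂ)
  simp only [fderiv_apply_eq_circleIntegral hf _ v]
  intro x₀
  refine DifferentiableAt.fun_const_smul (R := ℂ) ?_ _
  simp only [circleIntegral]
  -- The radius adds 1 for moving `x₀`, `‖v‖` for the circle and 1 for the Cauchy estimate.
  obtain ⟨C, hC⟩ := (isCompact_closedBall x₀ (‖v‖ + 2)).exists_bound_of_continuousOn
    hf.continuous.continuousOn
  set c : ℝ → ℂ := fun θ => deriv (circleMap 0 1) θ * (1 / (circleMap 0 1 θ - 0) ^ 2) with hc
  have hcc : Continuous c := by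
    simp only [hc, deriv_circleMap]
    refine Continuous.mul (by fun_prop) (Continuous.div (by fun_prop) (by fun_prop) ?_)
    intro θ
    simp
  have hcn : ∀ θ, ‖c θ‖ = 1 := by
    intro θ
    simp [hc, deriv_circleMap]
  have hFc : ∀ x, Continuous fun θ : ℝ => c θ • f (x + circleMap 0 1 θ • v) := by
    intro x
    refine hcc.smul (hf.continuous.comp ?_)
    fun_prop
  have main := intervalIntegral.hasFDerivAt_integral_of_dominated_of_fderiv_le
    (𝕜 := ℂ) (μ := MeasureTheory.volume) (a := 0) (b := 2 * Real.pi) (x₀ := x₀)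
    (F := fun x θ => c θ • f (x + circleMap 0 1 θ • v))
    (F' := fun x θ => c θ • fderiv ℂ f (x + circleMap 0 1 θ • v)) (bound := fun _ => C)
    (Metric.ball_mem_nhds x₀ one_pos)
    (Filter.Eventually.of_forall fun x => (hFc x).aestronglyMeasurable)
    ((hFc x₀).intervalIntegrable _ _) ?_ ?_ (by simp) ?_
  · refine (main.differentiableAt).congr_of_eventuallyEq (Filter.Eventually.of_forall fun x => ?_)
    simp only [hc, smul_eq_mul]
    simp only [mul_assoc]
  -- Continuity of `fderiv` is not yet available; measurability is enough here.
  · borelize E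
    have h1 : Measurable fun θ : ℝ => fderiv ℂ f (x₀ + circleMap 0 1 θ • v) := by
      refine (measurable_fderiv ℂ f).comp (Continuous.measurable ?_)
      fun_prop
    exact (hcc.measurable.smul h1).aestronglyMeasurable
  · refine Filter.Eventually.of_forall fun θ _ x hx => ?_
    rw [norm_smul, hcn, one_mul]
    refine norm_fderiv_le_of_bounded_near hf _ fun y hy => hC y ?_
    rw [mem_closedBall_iff_norm]
    have h2 : ‖x - x₀‖ < 1 := mem_ball_iff_norm.1 hx
    have h3 : ‖circleMap 0 1 θ • v‖ = ‖v‖ := by simp [norm_smul]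
    calc ‖y - x₀‖ = ‖(y - (x + circleMap 0 1 θ • v)) + (x - x₀) + circleMap 0 1 θ • v‖ := by
          congr 1; abel
      _ ≤ ‖y - (x + circleMap 0 1 θ • v)‖ + ‖x - x₀‖ + ‖circleMap 0 1 θ • v‖ := norm_add₃_le
      _ ≤ ‖v‖ + 2 := by linarith
  · refine Filter.Eventually.of_forall fun θ _ x _ => ?_
    refine HasFDerivAt.fun_const_smul (R := ℂ) ?_ _
    have := (hf (x + circleMap 0 1 θ • v)).hasFDerivAt.comp x
      ((hasFDerivAt_id x).add_const (circleMap 0 1 θ • v))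
    simpa using! this

lemma contDiff_of_differentiable [FiniteDimensional ℂ E] (n : ℕ) :
    ∀ {f : E → ℂ}, Differentiable ℂ f → ContDiff ℂ n f := by
  induction n with
  | zero => intro f hf; exact contDiff_zero.2 hf.continuous
  | succ n ih =>
    intro f hf
    rw [Nat.cast_succ, contDiff_succ_iff_fderiv]
    refine ⟨hf, by simp, ?_⟩
    rw [contDiff_clm_apply_iff]
    exact fun y => ih (differentiable_fderiv_apply hf y)

lemma fderiv_fderiv_apply_comm [FiniteDimensional ℂ E] {f : E → ℂ} (hf : Differentiable ℂ f)
    (v w : E) (z : E) :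
    fderiv ℂ (fun y => fderiv ℂ f y v) z w = fderiv ℂ (fun y => fderiv ℂ f y w) z v := by
  have h2 : ContDiff ℂ (2 : ℕ) f := contDiff_of_differentiable 2 hf
  have hs : IsSymmSndFDerivAt ℂ f z := h2.contDiffAt.isSymmSndFDerivAt (by simp)
  have hd : DifferentiableAt ℂ (fderiv ℂ f) z :=
    ((h2.fderiv_right (m := 1) (by norm_num)).differentiable (by simp)) z
  have key : ∀ a b : E, fderiv ℂ (fun y => fderiv ℂ f y a) z b = fderiv ℂ (fderiv ℂ f) z b a := by
    intro a b
    rw [fderiv_clm_apply hd (differentiableAt_const a)]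
    simp
  rw [key, key, hs]

end Smoothness

/-! ### Calculus of iterated partial derivatives. -/

section PartialDerivatives

variable {f g : EuclideanSpace ℂ (Fin d) → ℂ}

lemma differentiable_partialD (hf : Differentiable ℂ f) (i : Fin d) :
    Differentiable ℂ (partialD i f) :=
  differentiable_fderiv_apply hf _

lemma partialD_comm (hf : Differentiable ℂ f) (i j : Fin d) :
    partialD i (partialD j f) = partialD j (partialD i f) :=
  funext fun z => fderiv_fderiv_apply_comm hf _ _ z

lemma partialD_add (hf : Differentiable ℂ f) (hg : Differentiable ℂ g) (i : Fin d) :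
    partialD i (f + g) = partialD i f + partialD i g := by
  funext z
  simp [partialD, fderiv_add (hf z) (hg z)]

lemma partialD_smul (hf : Differentiable ℂ f) (c : ℂ) (i : Fin d) :
    partialD i (c • f) = c • partialD i f := by
  funext z
  simp [partialD, fderiv_const_smul (hf z) c]

lemma differentiable_coord (i : Fin d) :
    Differentiable ℂ (fun w : EuclideanSpace ℂ (Fin d) => w i) :=
  (EuclideanSpace.proj (𝕜 := ℂ) i).differentiable

lemma partialD_coord_mul (hf : Differentiable ℂ f) (i j : Fin d) :
    partialD j (fun w => w i * f w) =
      (if i = j then (1 : ℂ) else 0) • f + fun w => w i * partialD j f w := by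
  funext z
  have h : HasFDerivAt (fun w : EuclideanSpace ℂ (Fin d) => w i)
    (EuclideanSpace.proj (𝕜 := ℂ) i : EuclideanSpace ℂ (Fin d) →L[ℂ] ℂ) z :=
    (EuclideanSpace.proj (𝕜 := ℂ) i).hasFDerivAt
  have := (h.mul (hf z).hasFDerivAt).fderiv
  simp only [partialD]
  erw [this]
  by_cases hij : i = j
  · simp [hij]; ring
  · simp [hij]

lemma differentiable_partialD_iterate (hf : Differentiable ℂ f) (i : Fin d) (n : ℕ) :
    Differentiable ℂ ((partialD i)^[n] f) := by
  induction n with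
  | zero => exact hf
  | succ n ih => rw [Function.iterate_succ_apply']; exact differentiable_partialD ih i

lemma partialD_iterate_comm (hf : Differentiable ℂ f) (i j : Fin d) (n : ℕ) :
    partialD j ((partialD i)^[n] f) = (partialD i)^[n] (partialD j f) := by
  induction n with
  | zero => rfl
  | succ n ih =>
    rw [Function.iterate_succ_apply', Function.iterate_succ_apply', ← ih,
      partialD_comm (differentiable_partialD_iterate hf i n)]

/-- The partial derivative `∂^α f` restricted to the variables in the list `l`. -/
def listD (l : List (Fin d)) (α : Fin d →₀ ℕ) (f : EuclideanSpace ℂ (Fin d) → ℂ) :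
    EuclideanSpace ℂ (Fin d) → ℂ :=
  l.foldr (fun i g => (partialD i)^[α i] g) f

lemma listD_cons (i : Fin d) (l : List (Fin d)) (α : Fin d →₀ ℕ)
    (f : EuclideanSpace ℂ (Fin d) → ℂ) :
    listD (i :: l) α f = (partialD i)^[α i] (listD l α f) := rfl

lemma differentiable_listD (hf : Differentiable ℂ f) (l : List (Fin d)) (α : Fin d →₀ ℕ) :
    Differentiable ℂ (listD l α f) := by
  induction l with
  | nil => exact hf
  | cons i l ih => exact differentiable_partialD_iterate ih i _

lemma listD_congr {α γ : Fin d →₀ ℕ} {l : List (Fin d)} (h : ∀ i ∈ l, α i = γ i) :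
    listD l α f = listD l γ f := by
  induction l with
  | nil => rfl
  | cons i l ih =>
    rw [listD_cons, listD_cons, ih fun j hj => h j (List.mem_cons_of_mem _ hj),
      h i List.mem_cons_self]

lemma partialD_listD (hf : Differentiable ℂ f) (j : Fin d) (l : List (Fin d)) (α : Fin d →₀ ℕ) :
    partialD j (listD l α f) = listD l α (partialD j f) := by
  induction l with
  | nil => rfl
  | cons i l ih =>
    rw [listD_cons, listD_cons, partialD_iterate_comm (differentiable_listD hf l α), ih]

lemma listD_add_single (hf : Differentiable ℂ f) (i : Fin d) {l : List (Fin d)} (hl : l.Nodup)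
    (hi : i ∈ l) (α : Fin d →₀ ℕ) :
    listD l (α + Finsupp.single i 1) f = listD l α (partialD i f) := by
  induction l with
  | nil => simp at hi
  | cons j l ih =>
    rw [List.nodup_cons] at hl
    rw [listD_cons, listD_cons]
    rcases List.mem_cons.1 hi with rfl | hil
    · have : listD l (α + Finsupp.single i 1) f = listD l α f := listD_congr fun m hm => by
        have : m ≠ i := fun h => hl.1 (h ▸ hm)
        simp [this.symm]
      rw [this, ← partialD_listD hf]
      simp [Function.iterate_succ_apply]
    · have hji : j ≠ i := fun h => hl.1 (h ▸ hil)
      rw [ih hl.2 hil]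
      simp [hji.symm]

lemma multiD_eq_listD (α : Fin d →₀ ℕ) (f : EuclideanSpace ℂ (Fin d) → ℂ) :
    multiD α f = listD (List.finRange d) α f := rfl

lemma differentiable_multiD (hf : Differentiable ℂ f) (α : Fin d →₀ ℕ) :
    Differentiable ℂ (multiD α f) :=
  differentiable_listD hf _ α

lemma multiD_zero (f : EuclideanSpace ℂ (Fin d) → ℂ) : multiD 0 f = f := by
  rw [multiD_eq_listD]
  induction List.finRange d with
  | nil => rfl
  | cons i l ih => rw [listD_cons, ih]; rfl

lemma multiD_add_single (hf : Differentiable ℂ f) (i : Fin d) (α : Fin d →₀ ℕ) :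
    multiD (α + Finsupp.single i 1) f = multiD α (partialD i f) :=
  listD_add_single hf i (List.nodup_finRange d) (List.mem_finRange i) α

lemma multiIndex_induction {p : (Fin d →₀ ℕ) → Prop} (h0 : p 0)
    (h1 : ∀ α i, p α → p (α + Finsupp.single i 1)) (α : Fin d →₀ ℕ) : p α := by
  suffices H : ∀ γ α : Fin d →₀ ℕ, p α → p (α + γ) by simpa using H α 0 h0
  intro γ
  induction γ using Finsupp.induction_linear with
  | zero => simp
  | add x y hx hy => intro α hα; rw [← add_assoc]; exact hy _ (hx _ hα)
  | single i n =>
    induction n with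
    | zero => simp
    | succ n ih => intro α hα; rw [Finsupp.single_add, ← add_assoc]; exact h1 _ _ (ih _ hα)

lemma multiD_add_multiIndex (α γ : Fin d →₀ ℕ) :
    ∀ {f : EuclideanSpace ℂ (Fin d) → ℂ}, Differentiable ℂ f →
      multiD (α + γ) f = multiD γ (multiD α f) := by
  induction α using multiIndex_induction with
  | h0 => intro f _; rw [zero_add, multiD_zero]
  | h1 α i ih =>
    intro f hf
    rw [add_right_comm, multiD_add_single hf, ih (differentiable_partialD hf i),
      multiD_add_single hf]

lemma multiD_add (α : Fin d →₀ ℕ) : ∀ {f g : EuclideanSpace ℂ (Fin d) → ℂ},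
    Differentiable ℂ f → Differentiable ℂ g → multiD α (f + g) = multiD α f + multiD α g := by
  induction α using multiIndex_induction with
  | h0 => intro f g _ _; simp [multiD_zero]
  | h1 α i ih =>
    intro f g hf hg
    rw [multiD_add_single (hf.add hg), multiD_add_single hf, multiD_add_single hg,
      partialD_add hf hg, ih (differentiable_partialD hf i) (differentiable_partialD hg i)]

lemma multiD_smul (α : Fin d →₀ ℕ) (c : ℂ) : ∀ {f : EuclideanSpace ℂ (Fin d) → ℂ},
    Differentiable ℂ f → multiD α (c • f) = c • multiD α f := by
  induction α using multiIndex_induction with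
  | h0 => intro f _; simp [multiD_zero]
  | h1 α i ih =>
    intro f hf
    rw [multiD_add_single (hf.const_smul c), multiD_add_single hf, partialD_smul hf,
      ih (differentiable_partialD hf i)]

lemma multiD_const_zero (α : Fin d →₀ ℕ) :
    multiD α (0 : EuclideanSpace ℂ (Fin d) → ℂ) = 0 := by
  have h := multiD_smul α 0 (f := (0 : EuclideanSpace ℂ (Fin d) → ℂ)) (differentiable_const 0)
  simpa using h

lemma multiD_sum {ι : Type*} (s : Finset ι) (F : ι → EuclideanSpace ℂ (Fin d) → ℂ)
    (hF : ∀ i ∈ s, Differentiable ℂ (F i)) (α : Fin d →₀ ℕ) :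
    multiD α (∑ i ∈ s, F i) = ∑ i ∈ s, multiD α (F i) := by
  classical
  induction s using Finset.induction_on with
  | empty => simpa using multiD_const_zero α
  | insert i s hi ih =>
    have hs : ∀ j ∈ s, Differentiable ℂ (F j) := fun j hj => hF j (Finset.mem_insert_of_mem hj)
    rw [Finset.sum_insert hi, Finset.sum_insert hi, multiD_add α (hF i (Finset.mem_insert_self ..))
      (Differentiable.sum hs), ih hs]

/-- Leibniz's rule at the origin, where the term still carrying the factor `w i` vanishes. If `α i =
0`, the truncated subtraction is harmless because the coefficient is zero. -/
lemma multiD_coord_mul (i : Fin d) (α : Fin d →₀ ℕ) :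
    ∀ {f : EuclideanSpace ℂ (Fin d) → ℂ}, Differentiable ℂ f →
      multiD α (fun w => w i * f w) 0 = α i * multiD (α - Finsupp.single i 1) f 0 := by
  induction α using multiIndex_induction with
  | h0 => intro f _; simp [multiD_zero]
  | h1 α j ih =>
    intro f hf
    have hj := differentiable_partialD hf j
    rw [multiD_add_single ((differentiable_coord i).fun_mul hf), partialD_coord_mul hf,
      multiD_add α (hf.const_smul _) ((differentiable_coord i).fun_mul hj), multiD_smul α _ hf]
    simp only [Pi.add_apply, Pi.smul_apply, smul_eq_mul]
    rw [ih hj]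
    by_cases hij : i = j
    · subst hij
      rcases Nat.eq_zero_or_pos (α i) with h0 | hpos
      · simp [h0]
      · have h : α - Finsupp.single i 1 + Finsupp.single i 1 = α := by
          refine tsub_add_cancel_of_le ?_
          simpa using! hpos
        rw [← multiD_add_single hf, h]
        simp
        ring
    · rw [← multiD_add_single hf]
      have h : α - Finsupp.single i 1 + Finsupp.single j 1 =
          α + Finsupp.single j 1 - Finsupp.single i 1 := by
        ext m
        simp only [Finsupp.add_apply, Finsupp.tsub_apply, Finsupp.single_apply]
        split_ifs <;> simp_all
      rw [h]
      simp [hij]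

end PartialDerivatives

/-! ### Multi-index combinatorics and Bombieri's inequality. -/

section MultiIndices

open scoped Nat ComplexConjugate

/-- The multi-indices of degree `n`. -/
def degreeIndices (d n : ℕ) : Finset (Fin d →₀ ℕ) := Finset.finsuppAntidiag Finset.univ n

lemma mem_degreeIndices {n : ℕ} {α : Fin d →₀ ℕ} : α ∈ degreeIndices d n ↔ α.degree = n := by
  simp [degreeIndices, Finsupp.degree_eq_sum]

/-- The factorial `α! = α_1! ⋯ α_d!` of a multi-index. -/
def multiFactorial (α : Fin d →₀ ℕ) : ℕ := ∏ i, (α i)!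

lemma multiFactorial_pos (α : Fin d →₀ ℕ) : 0 < multiFactorial α :=
  Finset.prod_pos fun _ _ => Nat.factorial_pos _

lemma multiFactorial_ne_zero (α : Fin d →₀ ℕ) : (multiFactorial α : ℂ) ≠ 0 :=
  Nat.cast_ne_zero.2 (multiFactorial_pos α).ne'

lemma multiFactorial_zero : multiFactorial (0 : Fin d →₀ ℕ) = 1 := by simp [multiFactorial]

/-- The binomial coefficient of two multi-indices. -/
def multiChoose (α γ : Fin d →₀ ℕ) : ℕ := ∏ i, (α i).choose (γ i)

lemma multiChoose_mul_factorial {α γ : Fin d →₀ ℕ} (h : γ ≤ α) :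
    multiChoose α γ * multiFactorial γ * multiFactorial (α - γ) = multiFactorial α := by
  simp only [multiChoose, multiFactorial, ← Finset.prod_mul_distrib]
  exact Finset.prod_congr rfl fun i _ => Nat.choose_mul_factorial_mul_factorial (h i)

lemma multiChoose_eq_zero {α γ : Fin d →₀ ℕ} (h : ¬ γ ≤ α) : multiChoose α γ = 0 := by
  rw [Finsupp.le_def] at h
  push Not at h
  obtain ⟨i, hi⟩ := h
  exact Finset.prod_eq_zero (Finset.mem_univ i) (Nat.choose_eq_zero_of_lt hi)

lemma multiChoose_add (α μ β : Fin d →₀ ℕ) :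
    multiChoose (α + μ) β =
      ∑ x ∈ Finset.HasAntidiagonal.antidiagonal β, multiChoose α x.1 * multiChoose μ x.2 := by
  simp only [multiChoose, Finsupp.add_apply, Nat.add_choose_eq, Finset.prod_univ_sum,
    ← Finset.prod_mul_distrib]
  refine Finset.sum_bij'
    (fun x _ => (Finsupp.equivFunOnFinite.symm fun i => (x i).1,
      Finsupp.equivFunOnFinite.symm fun i => (x i).2))
    (fun y _ => fun i => (y.1 i, y.2 i)) ?_ ?_ ?_ ?_ ?_
  · intro x hx
    rw [Fintype.mem_piFinset] at hx
    rw [Finset.HasAntidiagonal.mem_antidiagonal]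
    ext i
    simpa using hx i
  · intro y hy
    rw [Finset.HasAntidiagonal.mem_antidiagonal] at hy
    rw [Fintype.mem_piFinset]
    intro i
    simp [← hy]
  · intro x _; rfl
  · intro y _; ext <;> rfl
  · intro x _; rfl

/-- Vandermonde's identity multiplied by `β! ν!`; the filter drops the terms whose binomial
coefficients vanish. -/
lemma multiFactorial_add_eq_sum {α μ β ν : Fin d →₀ ℕ} (h : α + μ = β + ν) :
    (multiFactorial (α + μ) : ℂ) =
      ∑ x ∈ (Finset.HasAntidiagonal.antidiagonal β).filter (fun x => x.1 ≤ α ∧ x.2 ≤ μ),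
        (multiFactorial α * multiFactorial μ * multiFactorial β * multiFactorial ν : ℂ) *
        (multiFactorial x.1 * multiFactorial (μ - x.2) * multiFactorial (α - x.1) *
          multiFactorial x.2 : ℂ)⁻¹ := by
  have hβ : β ≤ α + μ := h ▸ le_self_add
  have hν : α + μ - β = ν := by rw [h, add_tsub_cancel_left]
  have h1 := multiChoose_mul_factorial hβ
  rw [hν] at h1
  rw [← h1, multiChoose_add, Finset.sum_filter]
  push_cast
  rw [Finset.sum_mul, Finset.sum_mul]
  refine Finset.sum_congr rfl fun x _ => ?_
  split_ifs with hx
  · have e1 : (multiChoose α x.1 * multiFactorial x.1 * multiFactorial (α - x.1) : ℂ) =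
      multiFactorial α := by exact_mod_cast multiChoose_mul_factorial hx.1
    have e2 : (multiChoose μ x.2 * multiFactorial x.2 * multiFactorial (μ - x.2) : ℂ) =
      multiFactorial μ := by exact_mod_cast multiChoose_mul_factorial hx.2
    rw [← e1, ← e2]
    have := multiFactorial_ne_zero x.1
    have := multiFactorial_ne_zero x.2
    have := multiFactorial_ne_zero (α - x.1)
    have := multiFactorial_ne_zero (μ - x.2)
    field_simp
  · rw [not_and_or] at hx
    rcases hx with hx | hx <;> simp [multiChoose_eq_zero hx]

/-- The multi-indices of degree at most `n`. -/
def boundedIndices (d n : ℕ) : Finset (Fin d →₀ ℕ) :=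
  (Finset.range (n + 1)).biUnion (degreeIndices d)

lemma mem_boundedIndices {n : ℕ} {α : Fin d →₀ ℕ} :
    α ∈ boundedIndices d n ↔ α.degree ≤ n := by
  simp [boundedIndices, mem_degreeIndices]

/-- The inner sums in the expansion of the Fischer norm of a product. -/
def productKernel (p x : (Fin d →₀ ℕ) → ℂ) (n : ℕ) (γ l : Fin d →₀ ℕ) : ℂ :=
  ∑ s ∈ boundedIndices d n, (multiFactorial s : ℂ)⁻¹ *
    ((multiFactorial (γ + s) * p (γ + s)) * conj (multiFactorial (s + l) * x (s + l)))

/-- The Fischer norm of a product of homogeneous forms is a weighted sum of squares. -/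
lemma sum_norm_sq_product_eq {p x : (Fin d →₀ ℕ) → ℂ} {k m : ℕ}
    (hp : ∀ α, α.degree ≠ k → p α = 0) (hx : ∀ α, α.degree ≠ m → x α = 0) :
    (∑ δ ∈ degreeIndices d (k + m), multiFactorial δ *
      ‖∑ y ∈ Finset.HasAntidiagonal.antidiagonal δ, p y.1 * x y.2‖ ^ 2 : ℝ) =
    ∑ y ∈ boundedIndices d (k + m) ×ˢ boundedIndices d (k + m),
      (multiFactorial y.1 * multiFactorial y.2 : ℝ)⁻¹ * ‖productKernel p x (k + m) y.1 y.2‖ ^ 2 := by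
  have hL : ∀ δ : Fin d →₀ ℕ, ((multiFactorial δ *
      ‖∑ y ∈ Finset.HasAntidiagonal.antidiagonal δ, p y.1 * x y.2‖ ^ 2 : ℝ) : ℂ) =
      ∑ w ∈ (Finset.HasAntidiagonal.antidiagonal δ ×ˢ Finset.HasAntidiagonal.antidiagonal δ).sigma (fun w =>
        (Finset.HasAntidiagonal.antidiagonal w.2.1).filter (fun z => z.1 ≤ w.1.1 ∧ z.2 ≤ w.1.2)),
        (multiFactorial w.1.1.1 * multiFactorial w.1.1.2 * multiFactorial w.1.2.1 *
          multiFactorial w.1.2.2 : ℂ) *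
        (multiFactorial w.2.1 * multiFactorial (w.1.1.2 - w.2.2) *
          multiFactorial (w.1.1.1 - w.2.1) * multiFactorial w.2.2 : ℂ)⁻¹ *
        (p w.1.1.1 * x w.1.1.2 * conj (p w.1.2.1 * x w.1.2.2)) := by
    intro δ
    rw [Finset.sum_sigma]
    push_cast
    rw [← Complex.mul_conj', map_sum, Finset.sum_mul_sum, ← Finset.sum_product', Finset.mul_sum]
    refine Finset.sum_congr rfl fun w hw => ?_
    simp only [Finset.mem_product, Finset.HasAntidiagonal.mem_antidiagonal] at hw
    rw [← Finset.sum_mul, ← multiFactorial_add_eq_sum (hw.1.trans hw.2.symm), hw.1]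
  -- The kernel at `(γ, l)` is the Fischer pairing of `∂^γ p` with `∂^l x`.
  have hR : ∀ γ l : Fin d →₀ ℕ, (((multiFactorial γ * multiFactorial l : ℝ)⁻¹ *
      ‖productKernel p x (k + m) γ l‖ ^ 2 : ℝ) : ℂ) =
      ∑ z ∈ boundedIndices d (k + m) ×ˢ boundedIndices d (k + m),
        (multiFactorial γ * multiFactorial l * multiFactorial z.1 * multiFactorial z.2 : ℂ)⁻¹ *
        ((multiFactorial (γ + z.1) * p (γ + z.1)) * conj (multiFactorial (z.1 + l) * x (z.1 + l)) *
         (conj (multiFactorial (γ + z.2) * p (γ + z.2)) *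
          (multiFactorial (z.2 + l) * x (z.2 + l)))) := by
    intro γ l
    push_cast
    rw [← Complex.mul_conj', productKernel, map_sum, Finset.sum_mul_sum, ← Finset.sum_product',
      Finset.mul_sum]
    refine Finset.sum_congr rfl fun z _ => ?_
    simp only [map_mul, map_inv₀, Complex.conj_conj, Complex.conj_natCast, mul_inv]
    ring
  rw [← Complex.ofReal_inj, Complex.ofReal_sum, Complex.ofReal_sum]
  simp only [hL, hR]
  rw [← Finset.sum_product', Finset.sum_sigma']
  -- Both sides sum over 2×2 tables of multi-indices with rows `(γ, σ)` and `(τ, l)`: the row sums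
  -- are `α`, `μ` and the column sums are `β`, `ν`. Only nonzero terms are matched, since
  -- homogeneity is what confines the right-hand tables to total degree `k + m`.
  refine Finset.sum_bij_ne_zero
    (fun w _ _ => ((w.2.2.1, w.2.1.1.2 - w.2.2.2), (w.2.1.1.1 - w.2.2.1, w.2.2.2))) ?_ ?_ ?_ ?_
  · rintro ⟨δ, ⟨⟨⟨α, μ⟩, β, ν⟩, γ, τ⟩⟩ hw -
    simp only [Finset.mem_sigma, Finset.mem_product, Finset.HasAntidiagonal.mem_antidiagonal, Finset.mem_filter,
      mem_degreeIndices, mem_boundedIndices] at hw ⊢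
    obtain ⟨hδ, ⟨h1, h2⟩, h3, h4, h5⟩ := hw
    obtain ⟨σ, rfl⟩ := exists_add_of_le h4
    obtain ⟨l, rfl⟩ := exists_add_of_le h5
    subst h1
    simp only [map_add, add_tsub_cancel_left] at hδ ⊢
    omega
  · rintro ⟨δ, ⟨⟨⟨α, μ⟩, β, ν⟩, γ, τ⟩⟩ hw - ⟨δ', ⟨⟨⟨α', μ'⟩, β', ν'⟩, γ', τ'⟩⟩ hw' - heq
    simp only [Finset.mem_sigma, Finset.mem_product, Finset.HasAntidiagonal.mem_antidiagonal, Finset.mem_filter,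
      mem_degreeIndices, Prod.mk.injEq] at hw hw' heq
    obtain ⟨hδ, ⟨h1, h2⟩, h3, h4, h5⟩ := hw
    obtain ⟨hδ', ⟨h1', h2'⟩, h3', h4', h5'⟩ := hw'
    obtain ⟨σ, rfl⟩ := exists_add_of_le h4
    obtain ⟨l, rfl⟩ := exists_add_of_le h5
    obtain ⟨σ', rfl⟩ := exists_add_of_le h4'
    obtain ⟨l', rfl⟩ := exists_add_of_le h5'
    simp only [add_tsub_cancel_left] at heq
    obtain ⟨⟨rfl, rfl⟩, rfl, rfl⟩ := heq
    subst h1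
    subst h1'
    subst h3
    subst h3'
    have : ν = ν' := add_left_cancel (h2.trans h2'.symm)
    subst this
    rfl
  · rintro ⟨⟨γ, l⟩, σ, τ⟩ hz hne
    have hp1 : p (γ + σ) ≠ 0 := by rintro h; simp [h] at hne
    have hp2 : p (γ + τ) ≠ 0 := by rintro h; simp [h] at hne
    have hx1 : x (σ + l) ≠ 0 := by rintro h; simp [h] at hne
    have hx2 : x (τ + l) ≠ 0 := by rintro h; simp [h] at hne
    have dp1 := not_imp_comm.1 (hp _) hp1
    have dx2 := not_imp_comm.1 (hx _) hx2
    refine ⟨⟨γ + σ + (τ + l), ⟨⟨⟨γ + σ, τ + l⟩, γ + τ, σ + l⟩, γ, τ⟩⟩, ?_, ?_, ?_⟩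
    · simp only [Finset.mem_sigma, Finset.mem_product, Finset.HasAntidiagonal.mem_antidiagonal, Finset.mem_filter,
        mem_degreeIndices]
      refine ⟨by rw [map_add, dp1, dx2], ⟨trivial, by abel⟩, trivial, le_self_add,
        le_self_add⟩
    · simp [hp1, hp2, hx1, hx2, (multiFactorial_pos _).ne']
    · simp
  · rintro ⟨δ, ⟨⟨⟨α, μ⟩, β, ν⟩, γ, τ⟩⟩ hw -
    simp only [Finset.mem_sigma, Finset.mem_product, Finset.HasAntidiagonal.mem_antidiagonal, Finset.mem_filter,
      mem_degreeIndices] at hw ⊢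
    obtain ⟨hδ, ⟨h1, h2⟩, h3, h4, h5⟩ := hw
    obtain ⟨σ, rfl⟩ := exists_add_of_le h4
    obtain ⟨l, rfl⟩ := exists_add_of_le h5
    subst h1
    subst h3
    have : ν = σ + l := by
      have : γ + τ + ν = γ + τ + (σ + l) := h2.trans (by abel)
      exact add_left_cancel this
    subst this
    simp only [add_tsub_cancel_left, map_mul, Complex.conj_natCast]
    ring

/-- Bombieri's inequality, for one coefficient of the first factor. -/
lemma norm_sq_mul_sum_le_sum_product {p x : (Fin d →₀ ℕ) → ℂ} {k m : ℕ}
    (hp : ∀ α, α.degree ≠ k → p α = 0) (hx : ∀ α, α.degree ≠ m → x α = 0)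
    {γ : Fin d →₀ ℕ} (hγ : γ.degree = k) :
    ‖p γ‖ ^ 2 * ∑ l ∈ degreeIndices d m, (multiFactorial l * ‖x l‖ ^ 2 : ℝ) ≤
    ∑ δ ∈ degreeIndices d (k + m), multiFactorial δ *
      ‖∑ y ∈ Finset.HasAntidiagonal.antidiagonal δ, p y.1 * x y.2‖ ^ 2 := by
  -- Since `γ` already has the full degree of `p`, only `s = 0` survives and the kernel factors. All
  -- squares with another first index are then discarded.
  have hker : ∀ l, productKernel p x (k + m) γ l =
      (multiFactorial γ * p γ) * conj (multiFactorial l * x l) := by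
    intro l
    rw [productKernel, Finset.sum_eq_single 0]
    · simp [multiFactorial_zero]
    · intro s _ hs
      rw [hp (γ + s)]
      · simp
      · rw [map_add, hγ]
        have : s.degree ≠ 0 := by rwa [Ne, Finsupp.degree_eq_zero_iff]
        omega
    · intro h; exact absurd (mem_boundedIndices.2 (by simp)) h
  rw [sum_norm_sq_product_eq hp hx, Finset.mul_sum]
  have hγ1 : (1 : ℝ) ≤ multiFactorial γ := by exact_mod_cast multiFactorial_pos γ
  calc ∑ l ∈ degreeIndices d m, ‖p γ‖ ^ 2 * (multiFactorial l * ‖x l‖ ^ 2 : ℝ)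
      ≤ ∑ l ∈ degreeIndices d m, (multiFactorial γ * multiFactorial l : ℝ)⁻¹ *
        ‖productKernel p x (k + m) γ l‖ ^ 2 := by
        refine Finset.sum_le_sum fun l _ => ?_
        have hl : (0 : ℝ) < multiFactorial l := by exact_mod_cast multiFactorial_pos l
        rw [hker]
        simp only [norm_mul, RCLike.norm_conj, Complex.norm_natCast]
        have : (multiFactorial γ * multiFactorial l : ℝ)⁻¹ *
          (multiFactorial γ * ‖p γ‖ * (multiFactorial l * ‖x l‖)) ^ 2 =
          multiFactorial γ * (‖p γ‖ ^ 2 * (multiFactorial l * ‖x l‖ ^ 2)) := by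
          field_simp
        rw [this]
        exact le_mul_of_one_le_left (by positivity) hγ1
    _ = ∑ y ∈ {γ} ×ˢ degreeIndices d m, (multiFactorial y.1 * multiFactorial y.2 : ℝ)⁻¹ *
        ‖productKernel p x (k + m) y.1 y.2‖ ^ 2 := by
        rw [Finset.sum_product]; simp
    _ ≤ _ := by
        refine Finset.sum_le_sum_of_subset_of_nonneg ?_ fun _ _ _ => by positivity
        rintro ⟨a, b⟩ hab
        simp only [Finset.mem_product, Finset.mem_singleton, mem_degreeIndices,
          mem_boundedIndices] at hab ⊢
        rw [hab.1, hab.2, hγ]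
        omega

end MultiIndices

/-! ### Taylor coefficients and the Fischer norm of homogeneous parts. -/

section TaylorSeries

open scoped Nat ComplexConjugate

/-- The formal Taylor series at the origin. -/
def taylor (f : EuclideanSpace ℂ (Fin d) → ℂ) : MvPowerSeries (Fin d) ℂ :=
  fun α => multiD α f 0 / multiFactorial α

lemma coeff_taylor (f : EuclideanSpace ℂ (Fin d) → ℂ) (α : Fin d →₀ ℕ) :
    MvPowerSeries.coeff α (taylor f) = multiD α f 0 / multiFactorial α := rfl

lemma multiFactorial_mul_coeff_taylor (f : EuclideanSpace ℂ (Fin d) → ℂ) (α : Fin d →₀ ℕ) :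
    multiFactorial α * MvPowerSeries.coeff α (taylor f) = multiD α f 0 :=
  mul_div_cancel₀ _ (multiFactorial_ne_zero α)

lemma multiFactorial_add_single (α : Fin d →₀ ℕ) (i : Fin d) :
    multiFactorial (α + Finsupp.single i 1) = (α i + 1) * multiFactorial α := by
  simp only [multiFactorial]
  rw [← Finset.mul_prod_erase _ _ (Finset.mem_univ i),
    ← Finset.mul_prod_erase Finset.univ (fun j => (α j)!) (Finset.mem_univ i), ← mul_assoc]
  congr 1
  · simp [Nat.factorial_succ]
  · refine Finset.prod_congr rfl fun j hj => ?_
    simp [(Finset.ne_of_mem_erase hj).symm]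

lemma taylor_coord_mul {f : EuclideanSpace ℂ (Fin d) → ℂ} (hf : Differentiable ℂ f) (i : Fin d) :
    taylor (fun w => w i * f w) = MvPowerSeries.X i * taylor f := by
  ext α
  rw [coeff_taylor, multiD_coord_mul i α hf, MvPowerSeries.X, MvPowerSeries.coeff_monomial_mul,
    coeff_taylor, one_mul]
  split_ifs with h
  · obtain ⟨γ, rfl⟩ := exists_add_of_le h
    rw [add_tsub_cancel_left, add_comm, multiFactorial_add_single]
    have := multiFactorial_ne_zero γ
    have : ((γ i : ℂ) + 1) ≠ 0 := Nat.cast_add_one_ne_zero _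
    simp
    field_simp
  · have : α i = 0 := by
      by_contra h0
      apply h
      simpa using! Nat.pos_of_ne_zero h0
    simp [this]

lemma differentiable_eval (P : MvPolynomial (Fin d) ℂ) :
    Differentiable ℂ (fun w : EuclideanSpace ℂ (Fin d) => MvPolynomial.eval (fun i => w i) P) := by
  induction P using MvPolynomial.induction_on with
  | C a => simp
  | add p q hp hq => simpa using hp.fun_add hq
  | mul_X p i hp => simpa using hp.fun_mul (differentiable_coord i)

lemma taylor_eval_mul (P : MvPolynomial (Fin d) ℂ) :
    ∀ {f : EuclideanSpace ℂ (Fin d) → ℂ}, Differentiable ℂ f →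
      taylor (fun w => MvPolynomial.eval (fun i => w i) P * f w) =
        (P : MvPowerSeries (Fin d) ℂ) * taylor f := by
  induction P using MvPolynomial.induction_on with
  | C a =>
    intro f hf
    ext α
    have h : (fun w : EuclideanSpace ℂ (Fin d) =>
      MvPolynomial.eval (fun i => w i) (MvPolynomial.C a) * f w) = a • f := by
      funext w; simp
    rw [h, MvPolynomial.coe_C, MvPowerSeries.coeff_C_mul, coeff_taylor, coeff_taylor,
      multiD_smul α a hf]
    simp [mul_div_assoc]
  | add p q hp hq =>
    intro f hf
    rw [MvPolynomial.coe_add, add_mul, ← hp hf, ← hq hf]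
    ext α
    have h : (fun w : EuclideanSpace ℂ (Fin d) =>
      MvPolynomial.eval (fun i => w i) (p + q) * f w) =
      (fun w => MvPolynomial.eval (fun i => w i) p * f w) +
      (fun w => MvPolynomial.eval (fun i => w i) q * f w) := by
      funext w; simp [add_mul]
    rw [map_add, coeff_taylor, coeff_taylor, coeff_taylor, h,
      multiD_add α ((differentiable_eval p).fun_mul hf) ((differentiable_eval q).fun_mul hf)]
    simp [add_div]
  | mul_X p i hp =>
    intro f hf
    rw [MvPolynomial.coe_mul, MvPolynomial.coe_X, mul_assoc, ← taylor_coord_mul hf,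
      ← hp ((differentiable_coord i).fun_mul hf)]
    congr 1
    funext w
    simp [mul_assoc]

/-- Apply `∂^γ` to the differential equation and evaluate at the origin. -/
lemma sum_conj_coeff_mul_multiD_eq_zero {F : EuclideanSpace ℂ (Fin d) → ℂ}
    (hF : Differentiable ℂ F) {Q : MvPolynomial (Fin d) ℂ}
    (h : ∀ z, diffOp (conjCoeffs Q) F z = 0) (γ : Fin d →₀ ℕ) :
    ∑ α ∈ Q.support, conj (Q.coeff α) * multiD (α + γ) F 0 = 0 := by
  have hsupp : (conjCoeffs Q).support = Q.support :=
    MvPolynomial.support_map_of_injective Q (starRingEnd ℂ).injective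
  have h0 : ∑ α ∈ Q.support, conj (Q.coeff α) • multiD α F = 0 := by
    funext z
    have := h z
    rw [diffOp, hsupp] at this
    simpa [conjCoeffs, MvPolynomial.coeff_map] using this
  have h1 := multiD_sum Q.support (fun α => conj (Q.coeff α) • multiD α F)
    (fun α _ => (differentiable_multiD hF α).const_smul _) γ
  rw [h0, multiD_const_zero] at h1
  have h2 := congrFun h1 0
  simp only [Pi.zero_apply, Finset.sum_apply] at h2
  rw [h2]
  refine Finset.sum_congr rfl fun α _ => ?_
  rw [multiD_smul γ _ (differentiable_multiD hF α), multiD_add_multiIndex α γ hF]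
  rfl

lemma sum_degreeIndices_antidiagonal {g : (Fin d →₀ ℕ) → (Fin d →₀ ℕ) → ℂ} {k m : ℕ}
    (hg : ∀ α μ, α.degree ≠ k → g α μ = 0) :
    ∑ δ ∈ degreeIndices d (k + m), ∑ y ∈ Finset.HasAntidiagonal.antidiagonal δ, g y.1 y.2 =
      ∑ α ∈ degreeIndices d k, ∑ μ ∈ degreeIndices d m, g α μ := by
  rw [Finset.sum_sigma', ← Finset.sum_product']
  refine Finset.sum_bij_ne_zero (fun w _ _ => w.2) ?_ ?_ ?_ ?_
  · rintro ⟨δ, α, μ⟩ hw hne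
    simp only [Finset.mem_sigma, Finset.HasAntidiagonal.mem_antidiagonal, mem_degreeIndices,
      Finset.mem_product] at hw ⊢
    have h1 : α.degree = k := not_imp_comm.1 (hg α μ) hne
    have h2 := hw.1
    rw [← hw.2, map_add, h1] at h2
    exact ⟨h1, by omega⟩
  · rintro ⟨δ, α, μ⟩ hw - ⟨δ', α', μ'⟩ hw' - heq
    simp only [Finset.mem_sigma, Finset.HasAntidiagonal.mem_antidiagonal, Prod.mk.injEq] at *
    obtain ⟨rfl, rfl⟩ := heq
    obtain ⟨-, rfl⟩ := hw
    obtain ⟨-, rfl⟩ := hw'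
    rfl
  · rintro ⟨α, μ⟩ hw hne
    simp only [Finset.mem_product, mem_degreeIndices] at hw
    refine ⟨⟨α + μ, α, μ⟩, ?_, hne, rfl⟩
    simp [mem_degreeIndices, hw.1, hw.2]
  · intros; rfl

/-- The homogeneous part of degree `n` of a power series, with its coefficients scaled so that the
Euclidean norm is the Fischer norm. -/
def fischerVec (n : ℕ) :
    MvPowerSeries (Fin d) ℂ →ₗ[ℂ] EuclideanSpace ℂ (degreeIndices d n) where
  toFun F := WithLp.toLp 2 fun δ => (√(multiFactorial δ.1) : ℂ) * MvPowerSeries.coeff δ.1 F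
  map_add' F G := by ext δ; simp [mul_add]
  map_smul' c F := by ext δ; simp; ring

lemma fischerVec_apply (n : ℕ) (F : MvPowerSeries (Fin d) ℂ) (δ : degreeIndices d n) :
    fischerVec n F δ = (√(multiFactorial δ.1) : ℂ) * MvPowerSeries.coeff δ.1 F := rfl

lemma norm_fischerVec_sq (n : ℕ) (F : MvPowerSeries (Fin d) ℂ) :
    ‖fischerVec n F‖ ^ 2 =
      ∑ δ ∈ degreeIndices d n, multiFactorial δ * ‖MvPowerSeries.coeff δ F‖ ^ 2 := by
  rw [EuclideanSpace.norm_sq_eq, ← Finset.sum_coe_sort (degreeIndices d n)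
    (fun δ => multiFactorial δ * ‖MvPowerSeries.coeff δ F‖ ^ 2)]
  refine Finset.sum_congr rfl fun δ _ => ?_
  rw [fischerVec_apply, norm_mul, mul_pow, Complex.norm_real, Real.norm_eq_abs, sq_abs,
    Real.sq_sqrt (Nat.cast_nonneg _)]

lemma inner_fischerVec (n : ℕ) (F G : MvPowerSeries (Fin d) ℂ) :
    inner ℂ (fischerVec n F) (fischerVec n G) =
      ∑ δ ∈ degreeIndices d n, (multiFactorial δ * MvPowerSeries.coeff δ G : ℂ) *
        conj (MvPowerSeries.coeff δ F) := by
  rw [PiLp.inner_apply, ← Finset.sum_coe_sort (degreeIndices d n)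
    (fun δ => (multiFactorial δ * MvPowerSeries.coeff δ G : ℂ) *
        conj (MvPowerSeries.coeff δ F))]
  refine Finset.sum_congr rfl fun δ _ => ?_
  have h : ((√(multiFactorial δ.1) : ℝ) : ℂ) * (√(multiFactorial δ.1) : ℝ) =
      multiFactorial δ.1 := by
    rw [← Complex.ofReal_mul, Real.mul_self_sqrt (Nat.cast_nonneg _), Complex.ofReal_natCast]
  rw [RCLike.inner_apply, fischerVec_apply, fischerVec_apply, map_mul, Complex.conj_ofReal, ← h]
  ring

/-- Adjointness of multiplication by `Q` and `Q^*(D)`: in the expanded pairing, the conjugate of the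
`μ`-th coefficient of `G` is multiplied by `∂^μ (Q^*(D) F)` at the origin. -/
lemma inner_fischerVec_eq_zero {F : EuclideanSpace ℂ (Fin d) → ℂ} (hF : Differentiable ℂ F)
    {Q : MvPolynomial (Fin d) ℂ} {k : ℕ} (hQ : Q.IsHomogeneous k)
    (h : ∀ z, diffOp (conjCoeffs Q) F z = 0) (G : MvPowerSeries (Fin d) ℂ) (m : ℕ) :
    inner ℂ (fischerVec (k + m) ((Q : MvPowerSeries (Fin d) ℂ) * G))
      (fischerVec (k + m) (taylor F)) = 0 := by
  have hQ0 : ∀ α : Fin d →₀ ℕ, α.degree ≠ k → Q.coeff α = 0 := fun α hα =>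
    hQ.coeff_eq_zero hα
  rw [inner_fischerVec]
  have h1 : ∀ δ ∈ degreeIndices d (k + m),
      (multiFactorial δ * MvPowerSeries.coeff δ (taylor F) : ℂ) *
        conj (MvPowerSeries.coeff δ ((Q : MvPowerSeries (Fin d) ℂ) * G)) =
      ∑ y ∈ Finset.HasAntidiagonal.antidiagonal δ, conj (MvPowerSeries.coeff y.2 G) *
        (conj (Q.coeff y.1) * multiD (y.1 + y.2) F 0) := by
    intro δ _
    rw [multiFactorial_mul_coeff_taylor, MvPowerSeries.coeff_mul, map_sum, Finset.mul_sum]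
    refine Finset.sum_congr rfl fun y hy => ?_
    rw [Finset.HasAntidiagonal.mem_antidiagonal.1 hy, MvPolynomial.coeff_coe, map_mul]
    ring
  rw [Finset.sum_congr rfl h1, sum_degreeIndices_antidiagonal (g := fun α μ =>
    conj (MvPowerSeries.coeff μ G) * (conj (Q.coeff α) * multiD (α + μ) F 0))
    (fun α μ hα => by simp [hQ0 α hα]), Finset.sum_comm]
  refine Finset.sum_eq_zero fun μ _ => ?_
  rw [← Finset.mul_sum, ← Finset.sum_subset (s₁ := Q.support),
    sum_conj_coeff_mul_multiD_eq_zero hF h, mul_zero]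
  · intro α hα
    rw [mem_degreeIndices]
    by_contra hne
    exact MvPolynomial.mem_support_iff.1 hα (hQ0 α hne)
  · intro α _ hα
    rw [MvPolynomial.notMem_support_iff.1 hα]
    simp

/-- Bombieri's inequality for power series. What matters later is that the constant does not depend
on `m`. -/
lemma norm_coeff_mul_norm_fischerVec_le {Q : MvPolynomial (Fin d) ℂ} {k : ℕ}
    (hQ : Q.IsHomogeneous k) {γ : Fin d →₀ ℕ} (hγ : γ.degree = k)
    (F : MvPowerSeries (Fin d) ℂ) (m : ℕ) :
    ‖Q.coeff γ‖ * ‖fischerVec m F‖ ≤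
      ‖fischerVec (k + m) ((Q : MvPowerSeries (Fin d) ℂ) * F)‖ := by
  have hQ0 : ∀ α : Fin d →₀ ℕ, α.degree ≠ k → Q.coeff α = 0 := fun α hα =>
    hQ.coeff_eq_zero hα
  refine (pow_le_pow_iff_left₀ (by positivity) (norm_nonneg _) two_ne_zero).1 ?_
  set x : (Fin d →₀ ℕ) → ℂ := fun μ => if μ.degree = m then MvPowerSeries.coeff μ F else 0 with hx
  have key := norm_sq_mul_sum_le_sum_product (p := fun α => Q.coeff α) (x := x) (m := m) hQ0
    (fun α hα => by simp [hx, hα]) hγ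
  rw [mul_pow, norm_fischerVec_sq, norm_fischerVec_sq]
  refine (le_of_eq ?_).trans (key.trans_eq ?_)
  · refine congrArg _ (Finset.sum_congr rfl fun μ hμ => ?_)
    simp [hx, mem_degreeIndices.1 hμ]
  · refine (Finset.sum_congr rfl fun δ hδ => ?_).symm
    rw [MvPowerSeries.coeff_mul]
    congr 3
    refine Finset.sum_congr rfl fun y hy => ?_
    rw [MvPolynomial.coeff_coe]
    by_cases hy1 : y.1.degree = k
    · have h := mem_degreeIndices.1 hδ
      rw [← Finset.HasAntidiagonal.mem_antidiagonal.1 hy, map_add, hy1] at h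
      have : y.2.degree = m := by omega
      simp [hx, this]
    · simp [hQ0 _ hy1]

/-- The quotient `(α + μ)! / μ!` is a product of `|α|` factors, each at most `|α| + |μ|`. -/
lemma multiFactorial_add_le (α μ : Fin d →₀ ℕ) :
    multiFactorial (α + μ) ≤ (α.degree + μ.degree) ^ α.degree * multiFactorial μ := by
  rw [Finsupp.degree_eq_sum α, ← Finset.prod_pow_eq_pow_sum, multiFactorial, multiFactorial,
    ← Finset.prod_mul_distrib, ← Finsupp.degree_eq_sum α]
  refine Finset.prod_le_prod' fun i _ => ?_
  rw [Finsupp.add_apply, add_comm, ← Nat.factorial_mul_ascFactorial, mul_comm]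
  refine Nat.mul_le_mul_right _ ((Nat.ascFactorial_le_pow_add _ _).trans
    (Nat.pow_le_pow_left ?_ _))
  rw [add_comm]
  exact add_le_add (Finsupp.le_degree i α) (Finsupp.le_degree i μ)

/-- A monomial only shifts coefficients, so each squared weight grows by the factor `(α + μ)! / μ!`.
-/
lemma norm_fischerVec_monomial_mul_le (α : Fin d →₀ ℕ) (c : ℂ) (F : MvPowerSeries (Fin d) ℂ)
    (n : ℕ) :
    ‖fischerVec (α.degree + n) (MvPowerSeries.monomial α c * F)‖ ≤
      ‖c‖ * √((α.degree + n : ℝ) ^ α.degree) * ‖fischerVec n F‖ := by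
  refine (pow_le_pow_iff_left₀ (norm_nonneg _) (by positivity) two_ne_zero).1 ?_
  rw [mul_pow, mul_pow, norm_fischerVec_sq, norm_fischerVec_sq, Real.sq_sqrt (by positivity),
    Finset.mul_sum]
  have h1 : ∑ δ ∈ degreeIndices d (α.degree + n), (multiFactorial δ : ℝ) *
      ‖MvPowerSeries.coeff δ (MvPowerSeries.monomial α c * F)‖ ^ 2 =
      ∑ μ ∈ degreeIndices d n, (multiFactorial (α + μ) : ℝ) *
        (‖c‖ ^ 2 * ‖MvPowerSeries.coeff μ F‖ ^ 2) := by
    symm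
    refine Finset.sum_of_injOn (fun μ => α + μ) ?_ ?_ ?_ ?_
    · intro μ _ ν _ h; exact add_left_cancel h
    · intro μ hμ
      simp only [Finset.mem_coe, mem_degreeIndices] at hμ ⊢
      rw [map_add, hμ]
    · intro δ hδ hδ'
      rw [MvPowerSeries.coeff_monomial_mul, if_neg]
      · simp
      · intro hle
        obtain ⟨μ, rfl⟩ := exists_add_of_le hle
        refine hδ' ⟨μ, ?_, rfl⟩
        simp only [Finset.mem_coe, mem_degreeIndices, map_add] at hδ ⊢
        omega
    · intro μ _
      rw [MvPowerSeries.coeff_add_monomial_mul, norm_mul, mul_pow]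
  rw [h1]
  refine Finset.sum_le_sum fun μ hμ => ?_
  have h2 : (multiFactorial (α + μ) : ℝ) ≤ (α.degree + n : ℝ) ^ α.degree * multiFactorial μ := by
    have := multiFactorial_add_le α μ
    rw [mem_degreeIndices.1 hμ] at this
    exact_mod_cast this
  calc (multiFactorial (α + μ) : ℝ) * (‖c‖ ^ 2 * ‖MvPowerSeries.coeff μ F‖ ^ 2)
      ≤ ((α.degree + n : ℝ) ^ α.degree * multiFactorial μ) *
        (‖c‖ ^ 2 * ‖MvPowerSeries.coeff μ F‖ ^ 2) := by gcongr
    _ = _ := by ring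

lemma norm_fischerVec_mul_le {Q : MvPolynomial (Fin d) ℂ} {j : ℕ} (hQ : Q.IsHomogeneous j)
    (F : MvPowerSeries (Fin d) ℂ) (n : ℕ) :
    ‖fischerVec (j + n) ((Q : MvPowerSeries (Fin d) ℂ) * F)‖ ≤
      (∑ α ∈ Q.support, ‖Q.coeff α‖) * √((j + n : ℝ) ^ j) * ‖fischerVec n F‖ := by
  have hQs : (Q : MvPowerSeries (Fin d) ℂ) =
      ∑ α ∈ Q.support, MvPowerSeries.monomial α (Q.coeff α) := by
    conv_lhs => rw [Q.as_sum]
    rw [← MvPolynomial.coeToMvPowerSeries.ringHom_apply, map_sum]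
    simp
  rw [hQs, Finset.sum_mul, map_sum, Finset.sum_mul, Finset.sum_mul]
  refine (norm_sum_le _ _).trans (Finset.sum_le_sum fun α hα => ?_)
  have hα' : α.degree = j := by
    by_contra hne
    exact MvPolynomial.mem_support_iff.1 hα (hQ.coeff_eq_zero hne)
  subst hα'
  exact norm_fischerVec_monomial_mul_le α _ F n

end TaylorSeries

/-! ### Cauchy estimates, the identity theorem and the order of growth. -/

section Growth

open scoped Nat Topology
open Filter

variable {f : EuclideanSpace ℂ (Fin d) → ℂ}

lemma iteratedDeriv_comp_line (hf : Differentiable ℂ f) (i : Fin d) (n : ℕ)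
    (z : EuclideanSpace ℂ (Fin d)) (t : ℂ) :
    iteratedDeriv n (fun s : ℂ => f (z + s • EuclideanSpace.single i (1 : ℂ))) t =
      (partialD i)^[n] f (z + t • EuclideanSpace.single i (1 : ℂ)) := by
  induction n generalizing t with
  | zero => simp
  | succ n ih =>
    rw [iteratedDeriv_succ, funext ih, Function.iterate_succ_apply']
    exact (hasDerivAt_comp_line (differentiable_partialD_iterate hf i n) z _ t).deriv

lemma iteratedDeriv_comp_line_zero (hf : Differentiable ℂ f) (i : Fin d) (n : ℕ)
    (z : EuclideanSpace ℂ (Fin d)) :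
    iteratedDeriv n (fun s : ℂ => f (z + s • EuclideanSpace.single i (1 : ℂ))) 0 =
      (partialD i)^[n] f z := by
  rw [iteratedDeriv_comp_line hf, zero_smul, add_zero]

/-- One-variable Cauchy estimates, one coordinate at a time. The coordinates still to be treated are
kept at `0`, so moving one of them to the circle of radius `r` stays in the polydisc. -/
lemma norm_listD_le (hf : Differentiable ℂ f) {r K : ℝ} (hr : 0 < r)
    (hK : ∀ z : EuclideanSpace ℂ (Fin d), (∀ j, ‖z j‖ ≤ r) → ‖f z‖ ≤ K) (α : Fin d →₀ ℕ)
    {l : List (Fin d)} (hl : l.Nodup) (z : EuclideanSpace ℂ (Fin d)) (hz : ∀ j, ‖z j‖ ≤ r)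
    (hzl : ∀ j ∈ l, z j = 0) :
    ‖listD l α f z‖ ≤ (l.map fun i => ((α i)! : ℝ) / r ^ α i).prod * K := by
  induction l generalizing z with
  | nil => simpa [listD] using hK z hz
  | cons i l ih =>
    rw [List.nodup_cons] at hl
    have hD := differentiable_listD hf l α
    rw [listD_cons, ← iteratedDeriv_comp_line_zero hD, List.map_cons, List.prod_cons]
    refine (Complex.norm_iteratedDeriv_le_of_forall_mem_sphere_norm_le (α i) hr
      (differentiable_comp_line hD z _).diffContOnCl
      (C := (l.map fun i => ((α i)! : ℝ) / r ^ α i).prod * K) fun t ht => ?_).trans_eq (by ring)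
    have ht' : ‖t‖ = r := by simpa using ht
    have hzi : z i = 0 := hzl i List.mem_cons_self
    refine ih hl.2 _ (fun j => ?_) fun j hj => ?_
    · by_cases hji : j = i
      · subst hji
        simp [hzi, ht']
      · simpa [hji] using hz j
    · have hji : j ≠ i := fun h => hl.1 (h ▸ hj)
      simpa [hji] using hzl j (List.mem_cons_of_mem _ hj)

/-- Cauchy's estimate on a polydisc. -/
lemma norm_multiD_zero_le (hf : Differentiable ℂ f) {r K : ℝ} (hr : 0 < r)
    (hK : ∀ z : EuclideanSpace ℂ (Fin d), (∀ j, ‖z j‖ ≤ r) → ‖f z‖ ≤ K) (α : Fin d →₀ ℕ) :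
    ‖multiD α f 0‖ ≤ multiFactorial α / r ^ α.degree * K := by
  have h := norm_listD_le hf hr hK α (List.nodup_finRange d) 0 (fun j => by simpa using hr.le) (by simp)
  rw [← Fin.prod_univ_def, Finset.prod_div_distrib, Finset.prod_pow_eq_pow_sum,
    ← Finsupp.degree_eq_sum] at h
  simpa [multiFactorial, multiD_eq_listD] using h

/-- The identity theorem by removing one coordinate from `l` at a time: along that coordinate, an
entire function of one variable has zero Taylor series. -/
lemma eq_zero_of_listD_eq_zero (hf : Differentiable ℂ f) {l : List (Fin d)} (hl : l.Nodup)
    (h : ∀ α, ∀ z : EuclideanSpace ℂ (Fin d), (∀ j ∈ l, z j = 0) → listD l α f z = 0)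
    (z : EuclideanSpace ℂ (Fin d)) : f z = 0 := by
  induction l generalizing z with
  | nil => exact h 0 z (by simp)
  | cons i l ih =>
    rw [List.nodup_cons] at hl
    refine ih hl.2 (fun α y hy => ?_) z
    have hD := differentiable_listD hf l α
    set w : EuclideanSpace ℂ (Fin d) := y - y i • EuclideanSpace.single i (1 : ℂ) with hw
    have hyw : y = w + y i • EuclideanSpace.single i (1 : ℂ) := by rw [hw, sub_add_cancel]
    have hw0 : ∀ j ∈ i :: l, w j = 0 := by
      intro j hj
      rcases List.mem_cons.1 hj with rfl | hj
      · simp [hw]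
      · have hji : j ≠ i := fun h => hl.1 (h ▸ hj)
        simp [hw, hji, hy j hj]
    have hder : ∀ n, iteratedDeriv n
        (fun s : ℂ => listD l α f (w + s • EuclideanSpace.single i (1 : ℂ))) 0 = 0 := by
      intro n
      rw [iteratedDeriv_comp_line_zero hD]
      have := h (α.update i n) w hw0
      rw [listD_cons, Finsupp.update_apply, if_pos rfl] at this
      rwa [listD_congr (γ := α)] at this
      intro j hj
      have hji : j ≠ i := fun h => hl.1 (h ▸ hj)
      simp [Finsupp.update_apply, hji]
    have hT := Complex.taylorSeries_eq_of_entire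
      (differentiable_comp_line hD w (EuclideanSpace.single i (1 : ℂ))) 0 (y i)
    rw [hyw, ← hT]
    simp [hder]

lemma eq_zero_of_taylor_eq_zero (hf : Differentiable ℂ f)
    (h : ∀ α, MvPowerSeries.coeff α (taylor f) = 0) (z : EuclideanSpace ℂ (Fin d)) : f z = 0 := by
  refine eq_zero_of_listD_eq_zero hf (List.nodup_finRange d) (fun α y hy => ?_) z
  have hy0 : y = 0 := by ext j; simpa using hy j (List.mem_finRange j)
  rw [hy0, ← multiD_eq_listD, ← multiFactorial_mul_coeff_taylor, h, mul_zero]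

lemma norm_le_maxModulus (hf : Continuous f) (z : EuclideanSpace ℂ (Fin d)) :
    ‖f z‖ ≤ maxModulus f ‖z‖ := by
  refine le_csSup ?_ ⟨z, rfl, rfl⟩
  obtain ⟨C, hC⟩ := (isCompact_sphere (0 : EuclideanSpace ℂ (Fin d)) ‖z‖).exists_bound_of_continuousOn
    hf.continuousOn
  refine ⟨C, ?_⟩
  rintro x ⟨w, hw, rfl⟩
  exact hC w (by simpa using hw)

lemma exists_growth_bound (hf : Continuous f) {s : ℝ} (hs : order f < (s : EReal)) :
    ∃ C : ℝ, 0 < C ∧ ∀ z, ‖f z‖ ≤ C * Real.exp (‖z‖ ^ s) := by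
  have hev := eventually_lt_of_limsup_lt hs
  obtain ⟨R, hR⟩ := eventually_atTop.1 hev
  obtain ⟨C, hC⟩ := (isCompact_closedBall (0 : EuclideanSpace ℂ (Fin d))
    (max R 2)).exists_bound_of_continuousOn hf.continuousOn
  refine ⟨max C 1, by positivity, fun z => ?_⟩
  have hexp : 1 ≤ Real.exp (‖z‖ ^ s) := Real.one_le_exp (by positivity)
  by_cases hz : ‖z‖ ≤ max R 2
  · calc ‖f z‖ ≤ C := hC z (by simpa using hz)
      _ ≤ max C 1 * 1 := by simp
      _ ≤ _ := by gcongr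
  · push Not at hz
    have h1 : R ≤ ‖z‖ := (le_max_left _ _).trans hz.le
    have h2 : 1 < ‖z‖ := by linarith [le_max_right R 2]
    refine le_trans ?_ (le_mul_of_one_le_left (by positivity) (le_max_right C 1))
    -- When `‖f z‖ > 1` the maximum modulus exceeds 1, so both logarithms have positive arguments
    -- and no default value of `Real.log` enters.
    rcases le_or_gt ‖f z‖ 1 with hle | hgt
    · exact hle.trans hexp
    · have hM := norm_le_maxModulus hf z
      set m := maxModulus f ‖z‖ with hm
      have hm1 : 1 < m := hgt.trans_le hM
      have hlog : 0 < Real.log m := Real.log_pos hm1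
      have h3 := hR ‖z‖ h1
      rw [EReal.coe_lt_coe_iff, ← hm, div_lt_iff₀ (Real.log_pos h2)] at h3
      have h4 : Real.log m ≤ ‖z‖ ^ s := by
        rw [← Real.exp_log hlog, Real.rpow_def_of_pos (by linarith)]
        exact Real.exp_le_exp.2 (by linarith)
      calc ‖f z‖ ≤ m := hM
        _ = Real.exp (Real.log m) := (Real.exp_log (by linarith)).symm
        _ ≤ _ := Real.exp_le_exp.2 h4

lemma norm_le_sqrt_mul {r : ℝ} (hr : 0 ≤ r) (z : EuclideanSpace ℂ (Fin d))
    (hz : ∀ j, ‖z j‖ ≤ r) : ‖z‖ ≤ √d * r := by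
  refine (pow_le_pow_iff_left₀ (norm_nonneg _) (by positivity) two_ne_zero).1 ?_
  rw [EuclideanSpace.norm_sq_eq, mul_pow, Real.sq_sqrt (Nat.cast_nonneg _)]
  calc ∑ i, ‖z i‖ ^ 2 ≤ ∑ _i : Fin d, r ^ 2 :=
        Finset.sum_le_sum fun i _ => pow_le_pow_left₀ (norm_nonneg _) (hz i) 2
    _ = _ := by simp

lemma card_degreeIndices_le (m : ℕ) : (degreeIndices d m).card ≤ (m + 1) ^ d := by
  have h : (degreeIndices d m).card ≤
      (Fintype.piFinset fun _ : Fin d => Finset.range (m + 1)).card := by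
    refine Finset.card_le_card_of_injOn (fun α => (α : Fin d → ℕ)) ?_
      (DFunLike.coe_injective.injOn)
    intro α hα
    simp only [Finset.mem_coe, mem_degreeIndices] at hα
    simp only [Finset.mem_coe, Fintype.mem_piFinset, Finset.mem_range, Nat.lt_succ_iff]
    exact fun i => hα ▸ Finsupp.le_degree i α
  simpa using h

lemma multiFactorial_le (α : Fin d →₀ ℕ) : multiFactorial α ≤ (α.degree)! := by
  rw [Finsupp.degree_eq_sum]
  exact Nat.le_of_dvd (Nat.factorial_pos _) (Nat.prod_factorial_dvd_factorial_sum _ _)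

/-- The crude count of at most `2^(dm)` multi-indices suffices, because geometric factors are
harmless in the limit below. -/
lemma norm_fischerVec_taylor_le (hf : Differentiable ℂ f) {r K : ℝ} (hr : 0 < r)
    (hK : ∀ z : EuclideanSpace ℂ (Fin d), (∀ j, ‖z j‖ ≤ r) → ‖f z‖ ≤ K) (m : ℕ) :
    ‖fischerVec m (taylor f)‖ ≤ (2 ^ d) ^ m * √(m !) * (K / r ^ m) := by
  have hK0 : 0 ≤ K := (norm_nonneg _).trans (hK 0 (fun j => by simpa using hr.le))
  refine (pow_le_pow_iff_left₀ (norm_nonneg _) (by positivity) two_ne_zero).1 ?_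
  rw [norm_fischerVec_sq, mul_pow, mul_pow, Real.sq_sqrt (Nat.cast_nonneg _)]
  have hterm : ∀ α ∈ degreeIndices d m,
      multiFactorial α * ‖MvPowerSeries.coeff α (taylor f)‖ ^ 2 ≤ (m ! : ℝ) * (K / r ^ m) ^ 2 := by
    intro α hα
    rw [mem_degreeIndices] at hα
    have hα0 : (0 : ℝ) < multiFactorial α := by exact_mod_cast multiFactorial_pos α
    have h1 : (multiFactorial α : ℝ) ≤ m ! := by exact_mod_cast hα ▸ multiFactorial_le α
    have h2 : ‖MvPowerSeries.coeff α (taylor f)‖ ≤ K / r ^ m := by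
      rw [coeff_taylor, norm_div, Complex.norm_natCast, div_le_iff₀ hα0]
      refine (norm_multiD_zero_le hf hr hK α).trans_eq ?_
      rw [hα]
      ring
    gcongr
  have hcard : ((degreeIndices d m).card : ℝ) ≤ ((2 ^ d) ^ m) ^ 2 := by
    have h1 : ((degreeIndices d m).card : ℝ) ≤ (m + 1 : ℝ) ^ d := by
      exact_mod_cast card_degreeIndices_le m
    have h2 : (m + 1 : ℝ) ≤ 2 ^ m := by exact_mod_cast Nat.lt_two_pow_self (n := m)
    have h3 : (1 : ℝ) ≤ (2 ^ d) ^ m := one_le_pow₀ (one_le_pow₀ one_le_two)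
    calc ((degreeIndices d m).card : ℝ) ≤ (m + 1 : ℝ) ^ d := h1
      _ ≤ (2 ^ m) ^ d := by gcongr
      _ = (2 ^ d) ^ m := by rw [← pow_mul, ← pow_mul, mul_comm]
      _ ≤ ((2 ^ d) ^ m) ^ 2 := le_self_pow₀ h3 two_ne_zero
  calc _ ≤ ∑ _α ∈ degreeIndices d m, (m ! : ℝ) * (K / r ^ m) ^ 2 := Finset.sum_le_sum hterm
    _ = (degreeIndices d m).card * ((m ! : ℝ) * (K / r ^ m) ^ 2) := by simp
    _ ≤ ((2 ^ d) ^ m) ^ 2 * ((m ! : ℝ) * (K / r ^ m) ^ 2) := by gcongr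
    _ = _ := by ring

lemma tendsto_weighted_norm_fischerVec (hf : Differentiable ℂ f) {C s g A : ℝ} (hs : 0 < s)
    (hC : 0 < C) (hfC : ∀ z, ‖f z‖ ≤ C * Real.exp (‖z‖ ^ s)) (hg : 0 ≤ g) (hgs : g + 1 / 2 < 1 / s)
    (hA : 0 ≤ A) :
    Tendsto (fun m : ℕ => A ^ m * (m ! : ℝ) ^ g * ‖fischerVec m (taylor f)‖) atTop (𝓝 0) := by
  set B : ℝ := A * 2 ^ d * Real.exp (√d ^ s) with hB
  set ε : ℝ := 1 / s - (g + 1 / 2) with hε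
  have hε0 : 0 < ε := by rw [hε]; linarith
  have hbound : ∀ m : ℕ, 1 ≤ m → A ^ m * (m ! : ℝ) ^ g * ‖fischerVec m (taylor f)‖ ≤
      C * (B * (m : ℝ) ^ (-ε)) ^ m := by
    intro m hm
    have hm0 : (0 : ℝ) < m := by exact_mod_cast hm
    -- With radius `m^(1/s)` the growth bound is only geometric in `m`, while Cauchy's estimate
    -- gains `m^(-m/s)`; this beats `(m!)^(g + 1/2)` by the margin `ε`.
    have hr : 0 < (m : ℝ) ^ (1 / s) := by positivity
    have h1 := norm_fischerVec_taylor_le hf hr (K := C * Real.exp (√d ^ s) ^ m) (fun z hz => by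
      refine (hfC z).trans ?_
      gcongr
      rw [← Real.exp_nat_mul]
      refine Real.exp_le_exp.2 ?_
      calc ‖z‖ ^ s ≤ (√d * (m : ℝ) ^ (1 / s)) ^ s := by
            gcongr
            exact norm_le_sqrt_mul hr.le z hz
        _ = m * √d ^ s := by
            rw [Real.mul_rpow (by positivity) hr.le, ← Real.rpow_mul hm0.le, one_div,
              inv_mul_cancel₀ hs.ne', Real.rpow_one, mul_comm]) m
    have h2 : (m ! : ℝ) ^ g * √(m !) ≤ ((m : ℝ) ^ (g + 1 / 2)) ^ m := by
      have hfp : (0 : ℝ) < m ! := by positivity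
      rw [Real.sqrt_eq_rpow, ← Real.rpow_add hfp, ← Real.rpow_mul_natCast hm0.le, mul_comm _ (m : ℝ),
        Real.rpow_natCast_mul hm0.le]
      gcongr
      exact_mod_cast Nat.factorial_le_pow m
    calc A ^ m * (m ! : ℝ) ^ g * ‖fischerVec m (taylor f)‖
        ≤ A ^ m * (m ! : ℝ) ^ g * ((2 ^ d) ^ m * √(m !) *
          (C * Real.exp (√d ^ s) ^ m / ((m : ℝ) ^ (1 / s)) ^ m)) := by gcongr
      _ = A ^ m * (2 ^ d) ^ m * (C * Real.exp (√d ^ s) ^ m / ((m : ℝ) ^ (1 / s)) ^ m) *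
          ((m ! : ℝ) ^ g * √(m !)) := by ring
      _ ≤ A ^ m * (2 ^ d) ^ m * (C * Real.exp (√d ^ s) ^ m / ((m : ℝ) ^ (1 / s)) ^ m) *
          ((m : ℝ) ^ (g + 1 / 2)) ^ m := by gcongr
      _ = C * (B * ((m : ℝ) ^ (g + 1 / 2) / (m : ℝ) ^ (1 / s))) ^ m := by
          rw [hB, mul_pow, mul_pow, mul_pow, div_pow]; ring
      _ = C * (B * (m : ℝ) ^ (-ε)) ^ m := by
          rw [← Real.rpow_sub hm0, hε, neg_sub]
  have hlim : Tendsto (fun m : ℕ => B * (m : ℝ) ^ (-ε)) atTop (𝓝 0) := by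
    have := ((tendsto_rpow_neg_atTop hε0).comp tendsto_natCast_atTop_atTop).const_mul B
    simpa using! this
  have hB0 : 0 ≤ B := by positivity
  have hpow : Tendsto (fun m : ℕ => C * (1 / 2 : ℝ) ^ m) atTop (𝓝 0) := by
    simpa using (tendsto_pow_atTop_nhds_zero_of_lt_one (by norm_num : (0 : ℝ) ≤ 1 / 2)
      (by norm_num)).const_mul C
  refine squeeze_zero' (Eventually.of_forall fun m => by positivity) ?_ hpow
  filter_upwards [hlim.eventually_le_const (by norm_num : (0 : ℝ) < 1 / 2),
    eventually_ge_atTop 1] with m hm hm1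
  refine (hbound m hm1).trans ?_
  gcongr

end Growth

/-! ### The recursion towards higher degrees and its weights. -/

section Recursion

open scoped Topology
open Filter

/-- A positive value would be matched or exceeded at arbitrarily large indices, against the limit
`0`. -/
lemma eq_zero_of_tendsto_of_exists_le {c : ℕ → ℝ} (hc : ∀ n, 0 ≤ c n)
    (hlim : Tendsto c atTop (𝓝 0)) (h : ∀ M, 0 < c M → ∃ n > M, c M ≤ c n) (M : ℕ) : c M = 0 := by
  by_contra hne
  have hpos : 0 < c M := lt_of_le_of_ne (hc M) (Ne.symm hne)
  obtain ⟨N, hN⟩ := eventually_atTop.1 (hlim.eventually_lt_const hpos)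
  have hstep : ∀ j : ℕ, ∃ n ≥ j, c M ≤ c n := by
    intro j
    induction j with
    | zero => exact ⟨M, Nat.zero_le _, le_rfl⟩
    | succ j ih =>
      obtain ⟨n, hn, hle⟩ := ih
      obtain ⟨n', hn', hle'⟩ := h n (hpos.trans_le hle)
      exact ⟨n', by omega, hle.trans hle'⟩
  obtain ⟨n, hn, hle⟩ := hstep N
  exact absurd (hN n hn) (not_lt.2 hle)

/-- The factorial weight gains at least `(M + 1)^((k - j) g)`, which must cover the loss of order
`M^(j/2)`. The exponent `g` is the least with `j/2 ≤ (k - j) g` for all `j ≤ β`, with equality at `j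
= β`. -/
lemma factorial_rpow_mul_sqrt_le {k β j : ℕ} (hβ : β < k) (hj : j ≤ β) (M : ℕ) :
    (M.factorial : ℝ) ^ ((β : ℝ) / (2 * ((k : ℝ) - β))) * √((k + M : ℝ) ^ j) ≤
      (k : ℝ) ^ k * ((k - j + M).factorial : ℝ) ^ ((β : ℝ) / (2 * ((k : ℝ) - β))) := by
  set g : ℝ := (β : ℝ) / (2 * ((k : ℝ) - β)) with hg
  have hkβ : (0 : ℝ) < (k : ℝ) - β := by
    have : (β : ℝ) < k := by exact_mod_cast hβ
    linarith
  have hjβ : (j : ℝ) ≤ β := by exact_mod_cast hj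
  have hk1 : (1 : ℝ) ≤ k := by exact_mod_cast (by omega : 1 ≤ k)
  have hg0 : 0 ≤ g := by positivity
  have hM0 : (0 : ℝ) ≤ M := Nat.cast_nonneg _
  have h1 : √((k + M : ℝ) ^ j) ≤ (k : ℝ) ^ k * (M + 1 : ℝ) ^ ((j : ℝ) / 2) := by
    have e1 : (k + M : ℝ) ≤ k * (M + 1) := by nlinarith
    calc √((k + M : ℝ) ^ j) ≤ √((k * (M + 1) : ℝ) ^ j) := by gcongr
      _ = √((k : ℝ) ^ j) * √((M + 1 : ℝ) ^ j) := by
          rw [mul_pow, Real.sqrt_mul (by positivity)]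
      _ ≤ (k : ℝ) ^ k * (M + 1 : ℝ) ^ ((j : ℝ) / 2) := by
          gcongr
          · calc √((k : ℝ) ^ j) ≤ (k : ℝ) ^ j :=
                  Real.sqrt_le_iff.2 ⟨by positivity,
                    le_self_pow₀ (one_le_pow₀ hk1) two_ne_zero⟩
              _ ≤ (k : ℝ) ^ k := pow_le_pow_right₀ hk1 (by omega)
          · rw [Real.sqrt_eq_rpow, ← Real.rpow_natCast_mul (by positivity)]
            exact le_of_eq (by ring_nf)
  have h2 : (M + 1 : ℝ) ^ ((j : ℝ) / 2) ≤ ((M + 1 : ℝ) ^ (k - j)) ^ g := by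
    rw [← Real.rpow_natCast_mul (by positivity)]
    refine Real.rpow_le_rpow_of_exponent_le (by linarith) ?_
    rw [Nat.cast_sub (by omega), hg, ← mul_div_assoc, div_le_div_iff₀ two_pos (by positivity)]
    have hk0 : (0 : ℝ) ≤ k := by linarith
    nlinarith [mul_le_mul_of_nonneg_left hjβ hk0]
  have h3 : (M.factorial : ℝ) * (M + 1 : ℝ) ^ (k - j) ≤ ((k - j + M).factorial : ℝ) := by
    have := Nat.factorial_mul_pow_le_factorial (m := M) (n := k - j)
    rw [add_comm M (k - j)] at this
    exact_mod_cast this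
  calc (M.factorial : ℝ) ^ g * √((k + M : ℝ) ^ j)
      ≤ (M.factorial : ℝ) ^ g * ((k : ℝ) ^ k * ((M + 1 : ℝ) ^ (k - j)) ^ g) := by
        gcongr
        exact h1.trans (by gcongr)
    _ = (k : ℝ) ^ k * ((M.factorial : ℝ) * (M + 1 : ℝ) ^ (k - j)) ^ g := by
        rw [Real.mul_rpow (by positivity) (by positivity)]; ring
    _ ≤ _ := by gcongr

lemma exists_recursion_bound {k β : ℕ} (hk : 1 ≤ k) (hβ : β < k) {P : MvPolynomial (Fin d) ℂ}
    (hdeg : P.totalDegree = k)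
    (hP : P = ∑ j ∈ Finset.range (β + 1), MvPolynomial.homogeneousComponent j P
      + MvPolynomial.homogeneousComponent k P)
    {φ : EuclideanSpace ℂ (Fin d) → ℂ} (hφ : Differentiable ℂ φ)
    (heq : ∀ z, diffOp (conjCoeffs (MvPolynomial.homogeneousComponent k P))
      (fun w => MvPolynomial.eval (fun i => w i) P * φ w) z = 0) :
    ∃ S : ℕ → ℝ, (∀ j, 0 ≤ S j) ∧ ∀ M, ‖fischerVec M (taylor φ)‖ ≤
      ∑ j ∈ Finset.range (β + 1), S j * √((k + M : ℝ) ^ j) *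
        ‖fischerVec (k - j + M) (taylor φ)‖ := by
  set Q := MvPolynomial.homogeneousComponent k P with hQ
  have hQh : Q.IsHomogeneous k := MvPolynomial.homogeneousComponent_isHomogeneous k P
  -- A nonzero top-degree coefficient supplies the constant in Bombieri's inequality.
  have hQne : ∃ γ : Fin d →₀ ℕ, γ.degree = k ∧ Q.coeff γ ≠ 0 := by
    have hP0 : P.support.Nonempty := by
      rw [Finset.nonempty_iff_ne_empty, Ne, MvPolynomial.support_eq_empty]
      rintro rfl
      simp at hdeg
      omega
    obtain ⟨γ, hγ, hγ'⟩ := Finset.exists_mem_eq_sup P.support hP0 (fun s => s.sum fun _ e => e)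
    have hγk : γ.degree = k := by
      rw [← hdeg]
      exact hγ'.symm
    refine ⟨γ, hγk, ?_⟩
    rw [hQ, MvPolynomial.coeff_homogeneousComponent, if_pos hγk]
    exact MvPolynomial.mem_support_iff.1 hγ
  obtain ⟨γ, hγk, hγ⟩ := hQne
  have hp0 : 0 < ‖Q.coeff γ‖ := norm_pos_iff.2 hγ
  set R : ℕ → MvPolynomial (Fin d) ℂ := fun j => MvPolynomial.homogeneousComponent j P with hR
  refine ⟨fun j => ‖Q.coeff γ‖⁻¹ * ∑ α ∈ (R j).support, ‖(R j).coeff α‖,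
    fun j => by positivity, fun M => ?_⟩
  set f := taylor φ with hf
  have hT : taylor (fun w => MvPolynomial.eval (fun i => w i) P * φ w) =
      ∑ j ∈ Finset.range (β + 1), (R j : MvPowerSeries (Fin d) ℂ) * f +
        (Q : MvPowerSeries (Fin d) ℂ) * f := by
    rw [taylor_eval_mul P hφ, ← Finset.sum_mul, ← add_mul]
    congr 1
    conv_lhs => rw [hP]
    rw [MvPolynomial.coe_add, ← MvPolynomial.coeToMvPowerSeries.ringHom_apply (∑ _ ∈ _, _), map_sum]
    rfl
  have horth := inner_fischerVec_eq_zero ((differentiable_eval P).fun_mul hφ) hQh heq f M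
  set x := fischerVec (k + M) ((Q : MvPowerSeries (Fin d) ℂ) * f) with hx
  rw [hT, map_add, map_sum, ← hx, inner_add_right] at horth
  -- From `⟨x, y + x⟩ = 0` follows `‖x‖² = |⟨x, y⟩|`, and Cauchy–Schwarz concludes.
  have hxle : ‖x‖ ≤ ‖∑ j ∈ Finset.range (β + 1),
      fischerVec (k + M) ((R j : MvPowerSeries (Fin d) ℂ) * f)‖ := by
    set y := ∑ j ∈ Finset.range (β + 1), fischerVec (k + M) ((R j : MvPowerSeries (Fin d) ℂ) * f)
    have h1 : ‖x‖ * ‖x‖ ≤ ‖x‖ * ‖y‖ := by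
      calc ‖x‖ * ‖x‖ = ‖inner ℂ x x‖ := by
            rw [inner_self_eq_norm_sq_to_K]; simp [sq]
        _ = ‖inner ℂ x y‖ := by
            rw [← neg_eq_of_add_eq_zero_right horth, norm_neg]
        _ ≤ ‖x‖ * ‖y‖ := norm_inner_le_norm x y
    rcases (norm_nonneg x).eq_or_lt with h0 | h0
    · rw [← h0]; exact norm_nonneg _
    · exact le_of_mul_le_mul_left h1 h0
  have hlow := norm_coeff_mul_norm_fischerVec_le hQh hγk f M
  have hsum : ∀ j ∈ Finset.range (β + 1),
      ‖fischerVec (k + M) ((R j : MvPowerSeries (Fin d) ℂ) * f)‖ ≤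
      (∑ α ∈ (R j).support, ‖(R j).coeff α‖) * √((k + M : ℝ) ^ j) *
        ‖fischerVec (k - j + M) f‖ := by
    intro j hj
    have hjk : j ≤ k := by rw [Finset.mem_range] at hj; omega
    have h := norm_fischerVec_mul_le
      (MvPolynomial.homogeneousComponent_isHomogeneous j P) f (k - j + M)
    have e : j + (k - j + M) = k + M := by omega
    have e' : (j : ℝ) + ((k - j + M : ℕ) : ℝ) = k + M := by exact_mod_cast e
    rw [e, e'] at h
    exact h
  calc ‖fischerVec M f‖ = ‖Q.coeff γ‖⁻¹ * (‖Q.coeff γ‖ * ‖fischerVec M f‖) := by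
        field_simp
    _ ≤ ‖Q.coeff γ‖⁻¹ * ∑ j ∈ Finset.range (β + 1),
        (∑ α ∈ (R j).support, ‖(R j).coeff α‖) * √((k + M : ℝ) ^ j) *
        ‖fischerVec (k - j + M) f‖ := by
        gcongr
        exact hlow.trans (hxle.trans ((norm_sum_le _ _).trans (Finset.sum_le_sum hsum)))
    _ = _ := by
        rw [Finset.mul_sum]
        exact Finset.sum_congr rfl fun j _ => by ring

end Recursion

end Fischer

end

/-! ### The weighted norms of the homogeneous parts, and the conclusion. -/

theorem mainTheorem2 (d k β : ℕ) (hk : 2 ≤ k) (hβ : β ≤ k - 1)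
    (P : MvPolynomial (Fin d) ℂ) (hdeg : P.totalDegree = k)
    (hnonhom : ¬ ∃ m : ℕ, P.IsHomogeneous m)
    (hP : P = ∑ j ∈ Finset.range (β + 1), MvPolynomial.homogeneousComponent j P
      + MvPolynomial.homogeneousComponent k P)
    (φ : EuclideanSpace ℂ (Fin d) → ℂ) (hφ : Differentiable ℂ φ)
    (heq : ∀ z, Fischer.diffOp (Fischer.conjCoeffs (MvPolynomial.homogeneousComponent k P))
      (fun w => MvPolynomial.eval (fun i => w i) P * φ w) z = 0)
    (hord : Fischer.order φ < ((2 * ((k : ℝ) - (β : ℝ)) / (k : ℝ) : ℝ) : EReal)) :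
    ∀ z, φ z = 0 := by
  have hβk : β < k := by omega
  have hkβ : (0 : ℝ) < (k : ℝ) - β := by
    have : (β : ℝ) < k := by exact_mod_cast hβk
    linarith
  have hk0 : (0 : ℝ) < k := by exact_mod_cast (by omega : 0 < k)
  obtain ⟨t, ht1, ht2⟩ := EReal.lt_iff_exists_real_btwn.1 hord
  rw [EReal.coe_lt_coe_iff] at ht2
  set T : ℝ := 2 * ((k : ℝ) - β) / k with hT
  have hT0 : 0 < T := by positivity
  -- The number `t` may be nonpositive; the maximum keeps the exponent positive and still below `T`.
  set s : ℝ := max t (T / 2) with hs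
  have hs0 : 0 < s := lt_max_of_lt_right (by positivity)
  have hsT : s < T := max_lt ht2 (by linarith)
  obtain ⟨C, hC, hgrowth⟩ := Fischer.exists_growth_bound hφ.continuous (s := s)
    (ht1.trans_le (EReal.coe_le_coe_iff.2 (le_max_left _ _)))
  set g : ℝ := (β : ℝ) / (2 * ((k : ℝ) - β)) with hg
  have hg0 : 0 ≤ g := by positivity
  have hgs : g + 1 / 2 < 1 / s := by
    have h1 : g + 1 / 2 = 1 / T := by
      rw [hg, hT]
      field_simp
      ring
    rw [h1]
    exact one_div_lt_one_div_of_lt hs0 hsT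
  obtain ⟨S, hS0, hrec⟩ := Fischer.exists_recursion_bound (by omega) hβk hdeg hP hφ heq
  set a : ℕ → ℝ := fun m => ‖Fischer.fischerVec m (Fischer.taylor φ)‖ with ha
  set b : ℕ → ℝ := fun m => (m.factorial : ℝ) ^ g * a m with hb
  have hb0 : ∀ m, 0 ≤ b m := fun m => by positivity
  set U : ℕ → ℝ := fun j => S j * (k : ℝ) ^ k with hU
  have hU0 : ∀ j, 0 ≤ U j := fun j => mul_nonneg (hS0 j) (by positivity)
  have hbrec : ∀ M, b M ≤ ∑ j ∈ Finset.range (β + 1), U j * b (k - j + M) := by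
    intro M
    calc b M ≤ (M.factorial : ℝ) ^ g * ∑ j ∈ Finset.range (β + 1),
          S j * √((k + M : ℝ) ^ j) * a (k - j + M) := by
          simp only [hb]
          gcongr
          exact hrec M
      _ = ∑ j ∈ Finset.range (β + 1), S j * ((M.factorial : ℝ) ^ g * √((k + M : ℝ) ^ j)) *
          a (k - j + M) := by
          rw [Finset.mul_sum]
          exact Finset.sum_congr rfl fun j _ => by ring
      _ ≤ ∑ j ∈ Finset.range (β + 1), S j * ((k : ℝ) ^ k * ((k - j + M).factorial : ℝ) ^ g) *
          a (k - j + M) := by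
          refine Finset.sum_le_sum fun j hj => ?_
          have h := Fischer.factorial_rpow_mul_sqrt_le hβk
            (Nat.lt_succ_iff.1 (Finset.mem_range.1 hj)) M
          exact mul_le_mul_of_nonneg_right (mul_le_mul_of_nonneg_left h (hS0 j)) (norm_nonneg _)
      _ = _ := Finset.sum_congr rfl fun j _ => by simp only [hU, hb]; ring
  -- `A` exceeds the sum of the recursion constants. Since `k - j ≥ 1`, each later term carries at
  -- least one more factor `A`, so the later terms cannot all be smaller than `c M`.
  set A : ℝ := 1 + ∑ j ∈ Finset.range (β + 1), U j with hA
  have hA1 : 1 ≤ A := le_add_of_nonneg_right (Finset.sum_nonneg fun j _ => hU0 j)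
  set c : ℕ → ℝ := fun m => A ^ m * b m with hc
  have hc0 : ∀ m, 0 ≤ c m := fun m => mul_nonneg (by positivity) (hb0 m)
  have hclim : Filter.Tendsto c Filter.atTop (nhds 0) := by
    have := Fischer.tendsto_weighted_norm_fischerVec hφ hs0 hC hgrowth hg0 hgs
      (zero_le_one.trans hA1)
    simpa only [hc, hb, ha, mul_assoc] using this
  have hcstep : ∀ M, 0 < c M → ∃ n > M, c M ≤ c n := by
    intro M hM
    by_contra! hcon
    have h1 : ∀ j ∈ Finset.range (β + 1), A ^ (M + 1) * b (k - j + M) ≤ c M := by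
      intro j hj
      rw [Finset.mem_range] at hj
      refine le_trans ?_ (hcon (k - j + M) (by omega)).le
      exact mul_le_mul_of_nonneg_right (pow_le_pow_right₀ hA1 (by omega)) (hb0 _)
    have h2 : A * c M ≤ (∑ j ∈ Finset.range (β + 1), U j) * c M := by
      calc A * c M = A ^ (M + 1) * b M := by simp only [hc]; ring
        _ ≤ A ^ (M + 1) * ∑ j ∈ Finset.range (β + 1), U j * b (k - j + M) := by
            gcongr
            exact hbrec M
        _ = ∑ j ∈ Finset.range (β + 1), U j * (A ^ (M + 1) * b (k - j + M)) := by
            rw [Finset.mul_sum]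
            exact Finset.sum_congr rfl fun j _ => by ring
        _ ≤ ∑ j ∈ Finset.range (β + 1), U j * c M :=
            Finset.sum_le_sum fun j hj => mul_le_mul_of_nonneg_left (h1 j hj) (hU0 j)
        _ = _ := by rw [Finset.sum_mul]
    have h3 := le_of_mul_le_mul_right h2 hM
    linarith
  have hczero := Fischer.eq_zero_of_tendsto_of_exists_le hc0 hclim hcstep
  refine Fischer.eq_zero_of_taylor_eq_zero hφ fun α => ?_
  have hfac : (0 : ℝ) < (α.degree.factorial : ℝ) ^ g := by positivity
  have hA0 : 0 < A ^ α.degree := by positivity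
  have haz : a α.degree = 0 := by
    have h := hczero α.degree
    simp only [hc, hb, mul_eq_zero, hA0.ne', hfac.ne', false_or] at h
    exact h
  have hvec : Fischer.fischerVec α.degree (Fischer.taylor φ) = 0 := norm_eq_zero.1 haz
  have hcoord := congrArg
    (fun v => v (⟨α, Fischer.mem_degreeIndices.2 rfl⟩ : Fischer.degreeIndices d α.degree)) hvec
  simp only [Fischer.fischerVec_apply, PiLp.zero_apply, mul_eq_zero, Complex.ofReal_eq_zero] at hcoord
  refine hcoord.resolve_left (Real.sqrt_ne_zero'.2 ?_)
  exact_mod_cast Fischer.multiFactorial_pos α
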